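/- Let $c_0>0$, let $\gamma: J\to\mathbb R^3$ be a smooth unit-speed curve on an open interval $J\supseteq (s_1,s_2)$ (the flight path; for example an embedded curve), and let the surface $\Psi$ be given by a smooth embedding $\psi:U\to\mathbb R^3$, $(u,v)\mapsto\psi(u,v)$, of an open set $U\subseteq\mathbb R^2$ (for a general surface: in a local parametrization). Write $R(u,v,s)=\psi(u,v)-\gamma(s)$, $\hat R=R/|R|$, and let $\pi_{T\Psi}\hat R$ be the orthogonal projection of $\hat R$ to the tangent plane of $\Psi$ at $\psi(u,v)$, regarded as a covector by means of the induced metric, that is, with the components $\pi_{T\Psi}\hat R\cdot\partial_u\psi$ and $\pi_{T\Psi}\hat R\cdot\partial_v\psi$. Let $\mathcal Y=(s_1,s_2)\times(t_1,t_2)$ and $$\mathcal X=\Big\{(u,v)\in U:\ \tfrac{2}{c_0}|R(u,v,s)|\in(t_1,t_2)\text{ for some } s\in(s_1,s_2)\Big\}.$$ Let $A(s,t,u,v,\omega)$ be an amplitude (symbol) of order two on $\mathcal Y\times\mathcal X\times\mathbb R$, and let $F$ be the SAR forward operator $$FV(s,t)=\int_{\mathbb R\times\mathcal X}A(u,v,s,t,\omega)\,e^{-i\omega\left(t-\frac{2}{c_0}|R(u,v,s)|\right)}\,V(u,v)\,du\,dv\,d\omega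 ,\qquad V\in C_c^\infty(\mathcal X),$$ understood as an oscillatory integral with values in $\mathcal D'(\mathcal Y)$. Suppose that $\mathrm{dist}(\Psi,\gamma)>0$. Then: (a) $\phi(s,t,u,v,\omega)=\omega\left(t-\frac{2}{c_0}|R(u,v,s)|\right)$ is a non-degenerate phase function on $\mathcal Y\times\mathcal X\times(\mathbb R\setminus 0)$. (b) The set $$\Lambda=\Big\{(s,t,\sigma,\tau;u,v,\xi,\eta):\ t=\tfrac{2}{c_0}|R(u,v,s)|,\quad \sigma=\tfrac{2\tau}{c_0}\hat R(u,v,s)\cdot\dot\gamma(s),\quad (\xi,\eta)=-\tfrac{2\tau}{c_0}\pi_{T\Psi}\hat R(u,v,s)\Big\}$$ of nonzero covectors over points $(s,t)\in\mathcal Y$, $(u,v)\in\mathcal X$ is a closed conic Lagrangian submanifold of $T^*(\mathcal Y\times\mathcal X)\setminus 0$, and it is the image of $\{\phi_\omega=0\}$ under $(s,t,u,v,\omega)\mapsto(s,t,\phi_s,\phi_t;u,v,\phi_u,\phi_v)$. (c) The oscillatory integral converges and defines an operator $F$, and $F$ is a Fourier integral operator associated to $\Lambda$, of order $3/2$: its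 Schwartz kernel belongs to the class $I^{3/2}(\mathcal Y\times\mathcal X,\Lambda)$ of Lagrangian distributions. (In this class, amplitudes in $N$ phase variables have order $3/2+\frac44-\frac N2$.) -/

import Mathlib

open Set Filter Topology MeasureTheory TopologicalSpace
open scoped Distributions ContDiff ENNReal

noncomputable section

section Generic

variable {E : Type*} [NormedAddCommGroup E] [NormedSpace ℝ E]
variable {Θ : Type*} [NormedAddCommGroup Θ] [NormedSpace ℝ Θ]

/-- Symbols (amplitudes) of order `μ` and type `(1, 0)` on `W × Θ`, where `W` is an open subset
of `E`: smooth functions `a (x, θ)` such that, on every compact subset of `W`,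
`|∂_x^j ∂_θ^k a (x, θ)| ≤ C (1 + |θ|) ^ (μ - k)`. -/
def IsSymbol (μ : ℝ) (W : Set E) (a : E × Θ → ℂ) : Prop :=
  ContDiffOn ℝ ∞ a (W ×ˢ univ) ∧
  ∀ K : Set E, IsCompact K → K ⊆ W → ∀ j k : ℕ, ∃ C : ℝ, ∀ x ∈ K, ∀ θ : Θ,
    ‖iteratedFDeriv ℝ j (fun x' => iteratedFDeriv ℝ k (fun θ' => a (x', θ')) θ) x‖
      ≤ C * (1 + ‖θ‖) ^ (μ - k)

/-- The differential of `φ (x, θ)` in the base variable `x`. -/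
def dBase (φ : E × Θ → ℝ) (p : E × Θ) : E →L[ℝ] ℝ :=
  (fderiv ℝ φ p).comp (ContinuousLinearMap.inl ℝ E Θ)

/-- The differential of `φ (x, θ)` in the phase variable `θ`. -/
def dFibre (φ : E × Θ → ℝ) (p : E × Θ) : Θ →L[ℝ] ℝ :=
  (fderiv ℝ φ p).comp (ContinuousLinearMap.inr ℝ E Θ)

/-- A set of pairs `(x, θ)` (or `(x, covector)`) is conic if it is invariant under positive
dilations of the second component. -/
def IsConic {V : Type*} [SMul ℝ V] (U : Set (E × V)) : Prop :=
  ∀ p ∈ U, ∀ r : ℝ, 0 < r → (p.1, r • p.2) ∈ U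

/-- `φ` is a non-degenerate phase function on the open conic set `U` of pairs `(x, θ)`, `θ ≠ 0`:
it is smooth, positively homogeneous of degree one in `θ`, has no critical points, and at the
points where `φ_θ = 0` the differentials of the components of `φ_θ` are linearly independent,
that is, the differential of the map `φ_θ` is onto. -/
structure IsNondegeneratePhase (U : Set (E × Θ)) (φ : E × Θ → ℝ) : Prop where
  isOpen : IsOpen U
  ne_zero : ∀ p ∈ U, p.2 ≠ 0
  conic : IsConic U
  smooth : ContDiffOn ℝ ∞ φ U
  homogeneous : ∀ p ∈ U, ∀ r : ℝ, 0 < r → φ (p.1, r • p.2) = r * φ p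
  fderiv_ne_zero : ∀ p ∈ U, fderiv ℝ φ p ≠ 0
  nondegenerate : ∀ p ∈ U, dFibre φ p = 0 → Function.Surjective (fderiv ℝ (dFibre φ) p)

/-- The fibre-critical set `C = {φ_θ = 0}`. -/
def criticalSet (U : Set (E × Θ)) (φ : E × Θ → ℝ) : Set (E × Θ) :=
  {p ∈ U | dFibre φ p = 0}

/-- The map `(x, θ) ↦ (x, φ_x (x, θ))` into the cotangent bundle of `E`. -/
def lagrangianMap (φ : E × Θ → ℝ) (p : E × Θ) : E × (E →L[ℝ] ℝ) :=
  (p.1, dBase φ p)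

/-- The map `(x, θ) ↦ (x, φ_x)` is a diffeomorphism of the fibre-critical set of `φ` onto a
relatively open subset `Λ ∩ O` of `Λ`; its inverse is the restriction of a smooth map `g`. -/
def ParametrizesOpenPart (U : Set (E × Θ)) (φ : E × Θ → ℝ) (Λ : Set (E × (E →L[ℝ] ℝ))) : Prop :=
  ∃ (O : Set (E × (E →L[ℝ] ℝ))) (g : E × (E →L[ℝ] ℝ) → E × Θ),
    IsOpen O ∧ ContDiffOn ℝ ∞ g O ∧
    lagrangianMap φ '' criticalSet U φ = Λ ∩ O ∧
    ∀ p ∈ criticalSet U φ, g (lagrangianMap φ p) = p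

/-- The canonical symplectic form on the cotangent bundle of a vector space. -/
def canonicalSymplectic (a b : E × (E →L[ℝ] ℝ)) : ℝ := a.2 b.1 - b.2 a.1

/-- The cotangent bundle of `W` without its zero section. -/
def puncturedCotangent (W : Set E) : Set (E × (E →L[ℝ] ℝ)) := {p | p.1 ∈ W ∧ p.2 ≠ 0}

/-- `Λ` is a closed conic (embedded) Lagrangian submanifold of `T*W ∖ 0`. Locally, `Λ` is the
zero set of a submersion with values in `E`, so that it has dimension `2 n - n = n` if
`n = dim E`, and the symplectic form vanishes on its tangent spaces. -/
structure IsConicLagrangian (W : Set E) (Λ : Set (E × (E →L[ℝ] ℝ))) : Prop where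
  subset : Λ ⊆ puncturedCotangent W
  closed : ∃ Z : Set (E × (E →L[ℝ] ℝ)), IsClosed Z ∧ Λ = Z ∩ puncturedCotangent W
  conic : IsConic Λ
  lagrangian : ∀ p ∈ Λ, ∃ (O : Set (E × (E →L[ℝ] ℝ))) (f : E × (E →L[ℝ] ℝ) → E),
    IsOpen O ∧ p ∈ O ∧ ContDiffOn ℝ ∞ f O ∧ Λ ∩ O = {q ∈ O | f q = 0} ∧
    ∀ q ∈ Λ ∩ O, Function.Surjective (fderiv ℝ f q) ∧
      ∀ a b, fderiv ℝ f q a = 0 → fderiv ℝ f q b = 0 → canonicalSymplectic a b = 0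

/-- Cutoff functions used to regularize oscillatory integrals. -/
structure IsCutoff (χ : Θ → ℝ) : Prop where
  smooth : ContDiff ℝ ∞ χ
  compact : HasCompactSupport χ
  eq_one : ∀ᶠ θ in 𝓝 (0 : Θ), χ θ = 1

/-- `z` is the value at the test function `f` of the oscillatory integral
`∫ exp (i φ (x, θ)) a (x, θ) dθ`: the limit, for every cutoff `χ`, of the integrals in which the
amplitude is multiplied by `χ (ε θ)`, as `ε ↓ 0`. -/
def IsOscillatoryIntegral [MeasureSpace E] [MeasureSpace Θ]
    (φ : E × Θ → ℝ) (a : E × Θ → ℂ) (f : E → ℝ) (z : ℂ) : Prop :=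
  ∀ χ : Θ → ℝ, IsCutoff χ →
    Tendsto (fun ε : ℝ => ∫ x : E, ∫ θ : Θ,
      (χ (ε • θ) : ℂ) * Complex.exp (Complex.I * (φ (x, θ) : ℂ)) * a (x, θ) * (f x : ℂ))
      (𝓝[>] 0) (𝓝 z)

variable (E) in
/-- Data of an oscillatory integral with `N ≥ 1` phase variables: a phase `φ` on a set `U` and an
amplitude `a` with cone support in `Γ`. -/
structure OscillatoryData where
  N : ℕ
  N_pos : 0 < N
  U : Set (E × EuclideanSpace ℝ (Fin N))
  Γ : Set (E × EuclideanSpace ℝ (Fin N))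
  φ : E × EuclideanSpace ℝ (Fin N) → ℝ
  a : E × EuclideanSpace ℝ (Fin N) → ℂ

/-- The oscillatory integral is admissible over `W` for the Lagrangian `Λ` and the order `m`:
`φ` is a non-degenerate phase function on an open conic subset `U` of `W × (ℝ^N ∖ 0)` which
parametrizes an open part of `Λ`; `a` is a symbol of order `m + n / 4 - N / 2` (`n = dim E`), and
for `θ ≠ 0` it vanishes off a conic subset `Γ` of `U` that is closed in `W × (ℝ^N ∖ 0)`. -/
structure OscillatoryData.IsAdmissible (P : OscillatoryData E) (W : Set E)
    (Λ : Set (E × (E →L[ℝ] ℝ))) (m : ℝ) : Prop where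
  base : ∀ p ∈ P.U, p.1 ∈ W
  phase : IsNondegeneratePhase P.U P.φ
  parametrizes : ParametrizesOpenPart P.U P.φ Λ
  symbol : IsSymbol (m + (Module.finrank ℝ E : ℝ) / 4 - (P.N : ℝ) / 2) W P.a
  cone_subset : P.Γ ⊆ P.U
  cone_conic : IsConic P.Γ
  cone_closed : ∃ Z : Set (E × EuclideanSpace ℝ (Fin P.N)),
    IsClosed Z ∧ P.Γ = Z ∩ {p | p.1 ∈ W ∧ p.2 ≠ 0}
  support : ∀ p, p.1 ∈ W → p.2 ≠ 0 → p ∉ P.Γ → P.a p = 0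

/-- The space `I^m (W, Λ)` of Lagrangian distributions (Fourier integral distributions) of order
`m` on the open set `W` associated to `Λ`: near every point of `W`, the distribution is a finite
sum of oscillatory integrals whose non-degenerate phase functions parametrize parts of `Λ`,
plus a smooth function. Here `E` carries its Lebesgue measure. -/
def IsLagrangianDistribution [MeasureSpace E] (W : Opens E) (Λ : Set (E × (E →L[ℝ] ℝ))) (m : ℝ)
    (K : 𝓓'(W, ℂ)) : Prop :=
  ∀ x₀ ∈ W, ∃ W₀ : Set E, IsOpen W₀ ∧ x₀ ∈ W₀ ∧ W₀ ⊆ W ∧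
    ∃ (k : ℕ) (P : Fin k → OscillatoryData E) (r : E → ℂ),
      (∀ j, (P j).IsAdmissible W₀ Λ m) ∧ ContDiffOn ℝ ∞ r W₀ ∧
      ∀ f : 𝓓(W, ℝ), tsupport f ⊆ W₀ → ∃ z : Fin k → ℂ,
        (∀ j, IsOscillatoryIntegral (P j).φ (P j).a f (z j)) ∧
        K f = ∑ j, z j + ∫ x, r x * (f x : ℂ)

end Generic

section Operators

variable {E₁ E₂ : Type*} [NormedAddCommGroup E₁] [NormedSpace ℝ E₁]
  [NormedAddCommGroup E₂] [NormedSpace ℝ E₂]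

/-- The product of two open sets. -/
def opensProd (Y : Opens E₁) (X : Opens E₂) : Opens (E₁ × E₂) :=
  ⟨(Y : Set E₁) ×ˢ (X : Set E₂), Y.isOpen.prod X.isOpen⟩

/-- The test function `(y, x) ↦ g y * v x`. -/
def testTensor {Y : Opens E₁} {X : Opens E₂} (g : 𝓓(Y, ℝ)) (v : 𝓓(X, ℝ)) :
    𝓓(opensProd Y X, ℝ) where
  toFun p := g p.1 * v p.2
  contDiff' := (g.contDiff.comp contDiff_fst).mul (v.contDiff.comp contDiff_snd)
  hasCompactSupport' := by
    refine HasCompactSupport.intro (g.hasCompactSupport.isCompact.prod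
      v.hasCompactSupport.isCompact) ?_
    intro p hp
    by_cases h : p.1 ∈ tsupport g
    · have h2 : p.2 ∉ tsupport v := fun h2 => hp ⟨h, h2⟩
      rw [image_eq_zero_of_notMem_tsupport h2, mul_zero]
    · rw [image_eq_zero_of_notMem_tsupport h, zero_mul]
  tsupport_subset' := by
    have h : tsupport (fun p : E₁ × E₂ => g p.1 * v p.2) ⊆ tsupport g ×ˢ tsupport v := by
      refine closure_minimal ?_ ((isClosed_tsupport _).prod (isClosed_tsupport _))
      intro p hp
      have hp' : g p.1 * v p.2 ≠ 0 := hp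
      exact ⟨subset_tsupport _ (left_ne_zero_of_mul hp'),
        subset_tsupport _ (right_ne_zero_of_mul hp')⟩
    exact h.trans (Set.prod_mono g.tsupport_subset v.tsupport_subset)

/-- The real part of a test function. -/
def testRe {X : Opens E₂} (v : 𝓓(X, ℂ)) : 𝓓(X, ℝ) where
  toFun x := (v x).re
  contDiff' := Complex.reCLM.contDiff.comp v.contDiff
  hasCompactSupport' := v.hasCompactSupport.comp_left (g := Complex.re) rfl
  tsupport_subset' := (tsupport_comp_subset (g := Complex.re) rfl v).trans v.tsupport_subset

/-- The imaginary part of a test function. -/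
def testIm {X : Opens E₂} (v : 𝓓(X, ℂ)) : 𝓓(X, ℝ) where
  toFun x := (v x).im
  contDiff' := Complex.imCLM.contDiff.comp v.contDiff
  hasCompactSupport' := v.hasCompactSupport.comp_left (g := Complex.im) rfl
  tsupport_subset' := (tsupport_comp_subset (g := Complex.im) rfl v).trans v.tsupport_subset

/-- `K` is the Schwartz kernel of `F`: `⟨F v, g⟩ = ⟨K, g ⊗ v⟩`. Distributions are tested against
real functions, so that `g ⊗ v` is split into its real and imaginary parts. -/
def IsSchwartzKernel {Y : Opens E₁} {X : Opens E₂} (F : 𝓓(X, ℂ) →ₗ[ℂ] 𝓓'(Y, ℂ))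
    (K : 𝓓'(opensProd Y X, ℂ)) : Prop :=
  ∀ (v : 𝓓(X, ℂ)) (g : 𝓓(Y, ℝ)),
    F v g = K (testTensor g (testRe v)) + Complex.I * K (testTensor g (testIm v))

/-- `F` is a Fourier integral operator of order `m` from functions on `X` to distributions on `Y`,
associated to the closed conic Lagrangian submanifold `Λ` of `T*(Y × X) ∖ 0`: its Schwartz kernel
is a Lagrangian distribution of order `m` associated to `Λ`. -/
def IsFourierIntegralOperator [MeasureSpace E₁] [MeasureSpace E₂] {Y : Opens E₁} {X : Opens E₂}
    (Λ : Set ((E₁ × E₂) × (E₁ × E₂ →L[ℝ] ℝ))) (m : ℝ)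
    (F : 𝓓(X, ℂ) →ₗ[ℂ] 𝓓'(Y, ℂ)) : Prop :=
  IsConicLagrangian (opensProd Y X : Set (E₁ × E₂)) Λ ∧
  ∃ K : 𝓓'(opensProd Y X, ℂ), IsSchwartzKernel F K ∧ IsLagrangianDistribution (opensProd Y X) Λ m K

end Operators

/-- The distance `inf {d (x, y) : x ∈ S, y ∈ T}` between two sets. -/
def setEDist {α : Type*} [PseudoEMetricSpace α] (S T : Set α) : ℝ≥0∞ :=
  ⨅ x ∈ S, Metric.infEDist x T

/-- The geometry of a synthetic aperture radar experiment: the speed `c₀`, the data window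
`(s₁, s₂) × (t₁, t₂)`, the flight path `γ` (a smooth curve with unit speed, defined on an open
interval `J` containing `(s₁, s₂)`; besides all embedded ones this covers the periodic
parametrizations of embedded closed curves) and the surface `ψ` (a smooth embedding of an open subset
`U` of the plane of the parameters `(u, v)`). -/
structure SAR where
  c₀ : ℝ
  c₀_pos : 0 < c₀
  s₁ : ℝ
  s₂ : ℝ
  t₁ : ℝ
  t₂ : ℝ
  J : Set ℝ
  J_open : IsOpen J
  J_interval : J.OrdConnected
  window_subset : Ioo s₁ s₂ ⊆ J
  γ : ℝ → EuclideanSpace ℝ (Fin 3)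
  γ_smooth : ContDiffOn ℝ ∞ γ J
  γ_speed : ∀ s ∈ J, ‖deriv γ s‖ = 1
  U : Set (ℝ × ℝ)
  U_open : IsOpen U
  ψ : ℝ × ℝ → EuclideanSpace ℝ (Fin 3)
  ψ_smooth : ContDiffOn ℝ ∞ ψ U
  ψ_immersion : ∀ q ∈ U, Function.Injective (fderiv ℝ ψ q)
  ψ_embedding : IsEmbedding (U.domRestrict ψ)

namespace SAR

variable (D : SAR)

/-- The surface `Ψ`. -/
def surface : Set (EuclideanSpace ℝ (Fin 3)) := D.ψ '' D.U

/-- The flight path as a set. -/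
def path : Set (EuclideanSpace ℝ (Fin 3)) := D.γ '' D.J

/-- `R (u, v, s) = ψ (u, v) - γ (s)`, with `q = (u, v)`. -/
def R (q : ℝ × ℝ) (s : ℝ) : EuclideanSpace ℝ (Fin 3) := D.ψ q - D.γ s

/-- The unit vector `R / |R|`. -/
def Rhat (q : ℝ × ℝ) (s : ℝ) : EuclideanSpace ℝ (Fin 3) := ‖D.R q s‖⁻¹ • D.R q s

/-- The tangent plane of `Ψ` at `ψ q`. -/
def tangentPlane (q : ℝ × ℝ) : Submodule ℝ (EuclideanSpace ℝ (Fin 3)) :=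
  LinearMap.range (fderiv ℝ D.ψ q : ℝ × ℝ →ₗ[ℝ] EuclideanSpace ℝ (Fin 3))

/-- The orthogonal projection of `R / |R|` onto the tangent plane. -/
def projRhat (q : ℝ × ℝ) (s : ℝ) : EuclideanSpace ℝ (Fin 3) :=
  (D.tangentPlane q).starProjection (D.Rhat q s)

/-- The components, in the coordinates `(u, v)`, of the covector that the induced metric attaches
to the tangent vector `projRhat`: its inner products with `∂ψ/∂u` and `∂ψ/∂v`. -/
def projCovector (q : ℝ × ℝ) (s : ℝ) : ℝ × ℝ :=
  (inner ℝ (D.projRhat q s) (fderiv ℝ D.ψ q (1, 0)),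
   inner ℝ (D.projRhat q s) (fderiv ℝ D.ψ q (0, 1)))

/-- The data domain `𝒴 = (s₁, s₂) × (t₁, t₂)`. -/
def dataDomain : Opens (ℝ × ℝ) :=
  ⟨Ioo D.s₁ D.s₂ ×ˢ Ioo D.t₁ D.t₂, isOpen_Ioo.prod isOpen_Ioo⟩

/-- The visible set `𝒳`. -/
def visible : Opens (ℝ × ℝ) where
  carrier := {q ∈ D.U | ∃ s ∈ Ioo D.s₁ D.s₂, 2 / D.c₀ * ‖D.R q s‖ ∈ Ioo D.t₁ D.t₂}
  is_open' := by
    have h : {q ∈ D.U | ∃ s ∈ Ioo D.s₁ D.s₂, 2 / D.c₀ * ‖D.R q s‖ ∈ Ioo D.t₁ D.t₂}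
        = ⋃ s ∈ Ioo D.s₁ D.s₂,
          (D.U ∩ (fun q => 2 / D.c₀ * ‖D.R q s‖) ⁻¹' Ioo D.t₁ D.t₂) := by
      ext q
      simp only [mem_ofPred_eq, mem_iUnion, mem_inter_iff, mem_preimage, exists_prop]
      tauto
    rw [h]
    refine isOpen_biUnion fun s _ => ?_
    refine ContinuousOn.isOpen_inter_preimage ?_ D.U_open isOpen_Ioo
    exact continuousOn_const.mul (D.ψ_smooth.continuousOn.sub continuousOn_const).norm

/-- `𝒴 × 𝒳`, with points `((s, t), (u, v))`. -/
def base : Opens ((ℝ × ℝ) × (ℝ × ℝ)) := opensProd D.dataDomain D.visible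

/-- The phase function `ω (t - (2 / c₀) |R (u, v, s)|)` at the point `(((s, t), (u, v)), ω)`. -/
def phase (p : ((ℝ × ℝ) × (ℝ × ℝ)) × ℝ) : ℝ :=
  p.2 * (p.1.1.2 - 2 / D.c₀ * ‖D.R p.1.2 p.1.1.1‖)

/-- `𝒴 × 𝒳 × (ℝ ∖ 0)`. -/
def phaseDomain : Set (((ℝ × ℝ) × (ℝ × ℝ)) × ℝ) :=
  (D.base : Set ((ℝ × ℝ) × (ℝ × ℝ))) ×ˢ {w | w ≠ 0}

/-- The covector `σ ds + τ dt + ξ du + η dv`. -/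
def covector (σ τ ξ η : ℝ) : (ℝ × ℝ) × (ℝ × ℝ) →L[ℝ] ℝ :=
  let fst := ContinuousLinearMap.fst ℝ ℝ ℝ
  let snd := ContinuousLinearMap.snd ℝ ℝ ℝ
  let pY := ContinuousLinearMap.fst ℝ (ℝ × ℝ) (ℝ × ℝ)
  let pX := ContinuousLinearMap.snd ℝ (ℝ × ℝ) (ℝ × ℝ)
  σ • fst.comp pY + τ • snd.comp pY + ξ • fst.comp pX + η • snd.comp pX

/-- The Lagrangian of the forward operator, as a subset of `T*(𝒴 × 𝒳) ∖ 0`. -/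
def Λ : Set (((ℝ × ℝ) × (ℝ × ℝ)) × ((ℝ × ℝ) × (ℝ × ℝ) →L[ℝ] ℝ)) :=
  {p | ∃ s t σ τ u v ξ η : ℝ,
    p = (((s, t), (u, v)), covector σ τ ξ η) ∧
    (s, t) ∈ D.dataDomain ∧ (u, v) ∈ D.visible ∧ (σ, τ, ξ, η) ≠ 0 ∧
    t = 2 / D.c₀ * ‖D.R (u, v) s‖ ∧
    σ = 2 * τ / D.c₀ * inner ℝ (D.Rhat (u, v) s) (deriv D.γ s) ∧
    (ξ, η) = -(2 * τ / D.c₀) • D.projCovector (u, v) s}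

/-- The forward integral with the amplitude multiplied by `χ (ε ω)`, at `y = (s, t)`; the
variable of integration is `(ω, q)` with `q = (u, v)`. -/
def regularizedForward (A : ((ℝ × ℝ) × (ℝ × ℝ)) × ℝ → ℂ) (χ : ℝ → ℝ) (ε : ℝ)
    (V : ℝ × ℝ → ℂ) (y : ℝ × ℝ) : ℂ :=
  ∫ p : ℝ × (ℝ × ℝ) in univ ×ˢ (D.visible : Set (ℝ × ℝ)),
    (χ (ε * p.1) : ℂ) * A ((y, p.2), p.1)
      * Complex.exp (-Complex.I * (p.1 : ℂ) * ((y.2 - 2 / D.c₀ * ‖D.R p.2 y.1‖ : ℝ) : ℂ)) * V p.2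

/-- `F` is the forward operator with amplitude `A`,
`F V (s, t) = ∫ A exp (-i ω (t - (2 / c₀) |ψ (u, v) - γ (s)|)) V (u, v) du dv dω`,
the right side being understood as an oscillatory integral, that is, as the limit in the sense of
distributions on `𝒴` of the regularized integrals, for every cutoff. -/
def IsForwardOperator (A : ((ℝ × ℝ) × (ℝ × ℝ)) × ℝ → ℂ)
    (F : 𝓓(D.visible, ℂ) →ₗ[ℂ] 𝓓'(D.dataDomain, ℂ)) : Prop :=
  ∀ χ : ℝ → ℝ, IsCutoff χ → ∀ (V : 𝓓(D.visible, ℂ)) (g : 𝓓(D.dataDomain, ℝ)),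
    Tendsto (fun ε : ℝ => ∫ y in (D.dataDomain : Set (ℝ × ℝ)),
      D.regularizedForward A χ ε V y * (g y : ℂ)) (𝓝[>] 0) (𝓝 (F V g))

end SAR

end

noncomputable section

/-! ### Oscillating factors and integration by parts in the base variable. -/

section OscillatoryPairing

variable {E : Type*} [NormedAddCommGroup E] [NormedSpace ℝ E]
variable {Θ : Type*} [NormedAddCommGroup Θ] [NormedSpace ℝ Θ]

/-! The phase is `ω H` with `H = t - (2 / c₀) |R|`. Positive distance between surface and path makes
`R` nonzero, so `H` is smooth; and `∂H/∂t = 1`. These two facts are all that the analysis uses, so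
most of the argument is carried out for a smooth `H` on an open set `W` and a vector `e` with `dH(e)
= 1`.

Geometry: since `φ` is linear in `ω`, `φ_ω = H`, whose differential never vanishes. Hence `φ` is
non-degenerate, and the image of `{φ_ω = 0}` is the conormal bundle of the hypersurface `{H = 0}`
without its zero section. A conormal covector `r dH` takes the value `r` at `e`, which inverts the
parametrization and supplies global defining equations; isotropy is the symmetry of the second
derivative of `H` (`isConicLagrangian_conormalBundle`). The chain rule for `H` identifies this
bundle with `Λ` (`Λ_eq_conormalBundle`).

Analysis: for fixed `w`, integrate over the base first. Differentiation of `exp (-i w H)` along `e`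
produces the factor `-i w`, while base derivatives of a symbol do not raise its order, so `n`
integrations by parts bound the base integral by `(1 + |w|) ^ (m - n)`
(`exists_norm_fibreIntegral_le`). For large `n` this is integrable in `w`: the pairing is defined,
is bounded by finitely many derivatives of the test function, and is the limit of the regularized
integrals by Fubini and dominated convergence. The kernel is thus one global oscillatory integral
with `N = 1`, and its order is `m - 4/4 + 1/2 = m - 1/2`, which is `3/2` for `m = 2`. -/

theorem IsSymbol.exists_norm_iteratedFDeriv_base_le {m : ℝ} {W : Set E} {a : E × Θ → ℂ}
    (ha : IsSymbol m W a) {K : Set E} (hK : IsCompact K) (hKW : K ⊆ W) (n : ℕ) :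
    ∃ C : ℝ, 0 ≤ C ∧ ∀ j ≤ n, ∀ x ∈ K, ∀ θ : Θ,
      ‖iteratedFDeriv ℝ j (fun x' => a (x', θ)) x‖ ≤ C * (1 + ‖θ‖) ^ m := by
  choose c hc using fun j => ha.2 K hK hKW j 0
  -- One constant for all orders up to `n`; absolute values are taken because `c j` may be negative
  -- when `K` is empty.
  refine ⟨∑ j ∈ Finset.range (n + 1), |c j|, Finset.sum_nonneg fun _ _ => abs_nonneg _,
    fun j hj x hx θ => ?_⟩
  have h := hc j x hx θ
  have h0 : (fun x' => iteratedFDeriv ℝ 0 (fun θ' => a (x', θ')) θ)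
      = (continuousMultilinearCurryFin0 ℝ Θ ℂ).symm ∘ fun x' => a (x', θ) := by
    funext x'
    simp [iteratedFDeriv_zero_eq_comp]
  rw [h0, LinearIsometryEquiv.norm_iteratedFDeriv_comp_left] at h
  simp only [CharP.cast_eq_zero, sub_zero] at h
  refine h.trans ?_
  have h1 : c j ≤ ∑ j ∈ Finset.range (n + 1), |c j| :=
    (le_abs_self _).trans (Finset.single_le_sum (f := fun j => |c j|)
      (fun _ _ => abs_nonneg _) (Finset.mem_range.2 (Nat.lt_succ_of_le hj)))
  gcongr

theorem exists_norm_iteratedFDeriv_le {F : Type*} [NormedAddCommGroup F] [NormedSpace ℝ F]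
    {f : E → F} (hf : ContDiff ℝ ∞ f) (hc : HasCompactSupport f) (n : ℕ) :
    ∃ B : ℝ, 0 ≤ B ∧ ∀ i ≤ n, ∀ x, ‖iteratedFDeriv ℝ i f x‖ ≤ B := by
  choose b hb using fun i : ℕ => (hf.continuous_iteratedFDeriv (m := i)
    (by exact_mod_cast le_top)).bounded_above_of_compact_support (hc.iteratedFDeriv i)
  refine ⟨∑ i ∈ Finset.range (n + 1), |b i|, Finset.sum_nonneg fun _ _ => abs_nonneg _,
    fun i hi x => ?_⟩
  exact ((hb i x).trans (le_abs_self _)).trans (Finset.single_le_sum (f := fun i => |b i|)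
    (fun _ _ => abs_nonneg _) (Finset.mem_range.2 (Nat.lt_succ_of_le hi)))

theorem contDiff_mul_of_tsupport_subset {W : Set E} (hW : IsOpen W) {a f : E → ℂ}
    (ha : ContDiffOn ℝ ∞ a W) (hf : ContDiff ℝ ∞ f) (hfW : tsupport f ⊆ W) :
    ContDiff ℝ ∞ (fun x => a x * f x) := by
  refine contDiff_iff_contDiffAt.2 fun x => ?_
  by_cases hx : x ∈ tsupport f
  · exact (ha.contDiffAt (hW.mem_nhds (hfW hx))).mul hf.contDiffAt
  · have h : (fun x => a x * f x) =ᶠ[𝓝 x] fun _ => 0 := by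
      filter_upwards [(isClosed_tsupport f).isOpen_compl.mem_nhds hx] with y hy
      rw [image_eq_zero_of_notMem_tsupport hy, mul_zero]
    exact contDiffAt_const.congr_of_eventuallyEq h

theorem continuous_mul_of_tsupport_subset {X : Type*} [TopologicalSpace X] {W : Set X}
    (hW : IsOpen W) {a f : X → ℂ} (ha : ContinuousOn a W) (hf : Continuous f)
    (hfW : tsupport f ⊆ W) : Continuous (fun x => a x * f x) := by
  rw [continuous_iff_continuousAt]
  intro x
  by_cases hx : x ∈ tsupport f
  · exact (ha.continuousAt (hW.mem_nhds (hfW hx))).mul hf.continuousAt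
  · have h : (fun x => a x * f x) =ᶠ[𝓝 x] fun _ => 0 := by
      filter_upwards [(isClosed_tsupport f).isOpen_compl.mem_nhds hx] with y hy
      rw [image_eq_zero_of_notMem_tsupport hy, mul_zero]
    exact continuousAt_const.congr h.symm

/-- The oscillating factor `exp (-i w H)`. -/
def oscFactor {X : Type*} (H : X → ℝ) (w : ℝ) (x : X) : ℂ := Complex.exp (-(Complex.I * w * H x))

theorem norm_oscFactor {X : Type*} (H : X → ℝ) (w : ℝ) (x : X) : ‖oscFactor H w x‖ = 1 := by
  have h : -(Complex.I * w * H x) = ((-(w * H x) : ℝ) : ℂ) * Complex.I := by push_cast; ring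
  rw [oscFactor, h, Complex.norm_exp_ofReal_mul_I]

theorem ContDiffOn.oscFactor {W : Set E} {H : E → ℝ} (hH : ContDiffOn ℝ ∞ H W) (w : ℝ) :
    ContDiffOn ℝ ∞ (oscFactor H w) W := by
  have h : ContDiffOn ℝ ∞ (fun x => (H x : ℂ)) W := Complex.ofRealCLM.contDiff.comp_contDiffOn hH
  exact ((contDiffOn_const.mul h).neg).cexp

theorem fderiv_oscFactor {W : Set E} (hW : IsOpen W) {H : E → ℝ} (hH : ContDiffOn ℝ ∞ H W)
    (w : ℝ) {x : E} (hx : x ∈ W) (v : E) :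
    fderiv ℝ (oscFactor H w) x v = -(Complex.I * w * fderiv ℝ H x v) * oscFactor H w x := by
  have h1 : HasFDerivAt H (fderiv ℝ H x) x :=
    ((hH.contDiffAt (hW.mem_nhds hx)).differentiableAt (by simp)).hasFDerivAt
  have h2 : HasFDerivAt (fun x => (H x : ℂ)) (Complex.ofRealCLM.comp (fderiv ℝ H x)) x :=
    Complex.ofRealCLM.hasFDerivAt.comp x h1
  have h3 := ((h2.const_mul (Complex.I * w)).fun_neg).cexp
  have h4 := h3.fderiv
  change fderiv ℝ (fun x => Complex.exp (-(Complex.I * w * H x))) x v = _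
  rw [h4]
  simp [_root_.oscFactor]
  ring

/-- The integral over the base of an oscillatory integrand, for a fixed phase variable `w`. -/
def fibreIntegral {X : Type*} [MeasureSpace X] (H : X → ℝ) (A : X × ℝ → ℂ) (f : X → ℂ)
    (w : ℝ) : ℂ :=
  ∫ x, oscFactor H w x * (A (x, w) * f x)

/-- The oscillatory integral `∫ exp (-i w H) A f dx dw` of a test function `f`, computed with the
integration over the base first. -/
def oscPairing {X : Type*} [MeasureSpace X] (H : X → ℝ) (A : X × ℝ → ℂ) (f : X → ℂ) : ℂ :=
  ∫ w, fibreIntegral H A f w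

theorem oscPairing_const_mul {X : Type*} [MeasureSpace X] (H : X → ℝ) (A : X × ℝ → ℂ)
    (f : X → ℂ) (c : ℂ) :
    oscPairing H A (fun x => c * f x) = c * oscPairing H A f := by
  unfold oscPairing
  rw [← integral_const_mul]
  congr 1
  funext w
  unfold fibreIntegral
  rw [← integral_const_mul]
  congr 1
  funext x
  ring

variable [MeasureSpace E] [BorelSpace E] [(volume : Measure E).IsAddHaarMeasure]

theorem integrable_oscFactor_mul {W : Set E} (hW : IsOpen W) {H : E → ℝ}
    (hH : ContDiffOn ℝ ∞ H W) (w : ℝ) {u : E → ℂ} (hu : Continuous u)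
    (hc : HasCompactSupport u) (huW : tsupport u ⊆ W) :
    Integrable (fun x => oscFactor H w x * u x) :=
  (continuous_mul_of_tsupport_subset hW (hH.oscFactor w).continuousOn hu
    huW).integrable_of_hasCompactSupport hc.mul_left

variable [FiniteDimensional ℝ E]

/-- Since `dH(e) = 1`, the oscillating factor is an eigenfunction of the derivative along `e`, with
eigenvalue `-i w`. Integration by parts moves this derivative onto `u`; there is no boundary term
because `u` has compact support in `W`. -/
theorem integral_oscFactor_mul_fderiv {W : Set E} (hW : IsOpen W) {H : E → ℝ}
    (hH : ContDiffOn ℝ ∞ H W) {e : E} (he : ∀ x ∈ W, fderiv ℝ H x e = 1) (w : ℝ) {u : E → ℂ}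
    (hu : ContDiff ℝ ∞ u) (hc : HasCompactSupport u) (huW : tsupport u ⊆ W) :
    ∫ x, oscFactor H w x * fderiv ℝ u x e = Complex.I * w * ∫ x, oscFactor H w x * u x := by
  have hI : ∀ x, fderiv ℝ (oscFactor H w) x e * u x
      = -(Complex.I * w) * (oscFactor H w x * u x) := by
    intro x
    by_cases hx : x ∈ tsupport u
    · rw [fderiv_oscFactor hW hH w (huW hx), he x (huW hx)]
      push_cast
      ring
    · rw [image_eq_zero_of_notMem_tsupport hx]
      ring
  have hu1 : Continuous fun x => fderiv ℝ u x e :=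
    (hu.continuous_fderiv (by simp)).clm_apply continuous_const
  have hts : tsupport (fun x => fderiv ℝ u x e) ⊆ tsupport u :=
    tsupport_fderiv_apply_subset ℝ e
  have hc1 : HasCompactSupport fun x => fderiv ℝ u x e :=
    hc.of_isClosed_subset (isClosed_tsupport _) hts
  rw [integral_mul_fderiv_eq_neg_fderiv_mul_of_integrable]
  · simp_rw [hI]
    rw [integral_const_mul]
    ring
  · simp_rw [hI]
    exact (integrable_oscFactor_mul hW hH w hu.continuous hc huW).const_mul _
  · exact integrable_oscFactor_mul hW hH w hu1 hc1 (hts.trans huW)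
  · exact integrable_oscFactor_mul hW hH w hu.continuous hc huW
  · exact fun x hx => ((hH.oscFactor w).contDiffAt (hW.mem_nhds (huW hx))).differentiableAt (by simp)
  · exact fun x _ => hu.contDiffAt.differentiableAt (by simp)

theorem integral_oscFactor_mul_iteratedFDeriv {W : Set E} (hW : IsOpen W) {H : E → ℝ}
    (hH : ContDiffOn ℝ ∞ H W) {e : E} (he : ∀ x ∈ W, fderiv ℝ H x e = 1) (w : ℝ) {u : E → ℂ}
    (hu : ContDiff ℝ ∞ u) (hc : HasCompactSupport u) (huW : tsupport u ⊆ W) (n : ℕ) :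
    ∫ x, oscFactor H w x * iteratedFDeriv ℝ n u x (fun _ => e)
      = (Complex.I * w) ^ n * ∫ x, oscFactor H w x * u x := by
  induction n with
  | zero => simp
  | succ n ih =>
    have hd : ContDiff ℝ ∞ (iteratedFDeriv ℝ n u) :=
      hu.iteratedFDeriv_right (m := ∞) (by exact_mod_cast le_top)
    let L : (ContinuousMultilinearMap ℝ (fun _ : Fin n => E) ℂ) →L[ℝ] ℂ :=
      ContinuousMultilinearMap.apply ℝ (fun _ : Fin n => E) ℂ (fun _ => e)
    have hv : ContDiff ℝ ∞ fun x => iteratedFDeriv ℝ n u x (fun _ => e) := L.contDiff.comp hd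
    have hts : tsupport (fun x => iteratedFDeriv ℝ n u x (fun _ => e)) ⊆ tsupport u :=
      (tsupport_comp_subset (map_zero L) _).trans (tsupport_iteratedFDeriv_subset n)
    have hcv : HasCompactSupport fun x => iteratedFDeriv ℝ n u x (fun _ => e) :=
      hc.of_isClosed_subset (isClosed_tsupport _) hts
    have hs : ∀ x, iteratedFDeriv ℝ (n + 1) u x (fun _ => e)
        = fderiv ℝ (fun x => iteratedFDeriv ℝ n u x (fun _ => e)) x e := by
      intro x
      have h1 : HasFDerivAt (fun x => iteratedFDeriv ℝ n u x (fun _ => e))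
          (L.comp (fderiv ℝ (iteratedFDeriv ℝ n u) x)) x :=
        L.hasFDerivAt.comp x (hd.contDiffAt.differentiableAt (by simp)).hasFDerivAt
      rw [h1.fderiv, iteratedFDeriv_succ_apply_left]
      rfl
    simp_rw [hs]
    rw [integral_oscFactor_mul_fderiv hW hH he w hv hcv (hts.trans huW), ih, pow_succ]
    ring

end OscillatoryPairing

/-! ### Decay in the phase variable and convergence of the pairing. -/

section OscillatoryPairing

variable {E : Type*} [NormedAddCommGroup E] [NormedSpace ℝ E]

theorem IsSymbol.contDiffOn_base {Θ : Type*} [NormedAddCommGroup Θ] [NormedSpace ℝ Θ] {m : ℝ}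
    {W : Set E} {a : E × Θ → ℂ} (ha : IsSymbol m W a) (θ : Θ) :
    ContDiffOn ℝ ∞ (fun x => a (x, θ)) W :=
  ha.1.comp (contDiff_id.prodMk contDiff_const).contDiffOn fun _ hx => ⟨hx, mem_univ _⟩

/-- Leibniz rule. The constant is chosen before `f` and `w`; this uniformity later yields continuity
of the distributions. -/
theorem exists_norm_iteratedFDeriv_symbol_mul_le {m : ℝ} {W : Set E} (hW : IsOpen W)
    {A : E × ℝ → ℂ} (hA : IsSymbol m W A) {K : Set E} (hK : IsCompact K) (hKW : K ⊆ W) (n : ℕ) :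
    ∃ C : ℝ, 0 ≤ C ∧ ∀ (f : E → ℂ) (B : ℝ), ContDiff ℝ ∞ f →
      (∀ i ≤ n, ∀ x, ‖iteratedFDeriv ℝ i f x‖ ≤ B) → ∀ j ≤ n, ∀ x ∈ K, ∀ w : ℝ,
        ‖iteratedFDeriv ℝ j (fun x => A (x, w) * f x) x‖ ≤ C * B * (1 + ‖w‖) ^ m := by
  obtain ⟨C, hC0, hC⟩ := hA.exists_norm_iteratedFDeriv_base_le hK hKW n
  refine ⟨2 ^ n * C, by positivity, fun f B hf hB j hj x hx w => ?_⟩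
  have hB0 : 0 ≤ B := (norm_nonneg _).trans (hB 0 (Nat.zero_le _) x)
  -- The symbol is smooth only on `W`, so the product rule is applied within `W`, where derivatives
  -- agree with the full ones because `W` is open.
  have h := norm_iteratedFDerivWithin_mul_le (n := j) (hA.contDiffOn_base w) hf.contDiffOn
    hW.uniqueDiffOn (hKW hx) (by exact_mod_cast le_top)
  rw [iteratedFDerivWithin_of_isOpen j hW (hKW hx)] at h
  refine h.trans ?_
  calc _ ≤ ∑ i ∈ Finset.range (j + 1), (j.choose i : ℝ) * (C * (1 + ‖w‖) ^ m) * B := by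
        refine Finset.sum_le_sum fun i hi => ?_
        rw [iteratedFDerivWithin_of_isOpen i hW (hKW hx),
          iteratedFDerivWithin_of_isOpen (j - i) hW (hKW hx)]
        have hi' : i ≤ j := Nat.lt_succ_iff.1 (Finset.mem_range.1 hi)
        gcongr
        · exact hC i (hi'.trans hj) x hx w
        · exact hB (j - i) ((Nat.sub_le _ _).trans hj) x
    _ = 2 ^ j * (C * (1 + ‖w‖) ^ m) * B := by
        rw [← Finset.sum_mul, ← Finset.sum_mul, ← Nat.cast_sum, Nat.sum_range_choose]
        push_cast
        rfl
    _ ≤ 2 ^ n * (C * (1 + ‖w‖) ^ m) * B := by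
        have h2 : (2 : ℝ) ^ j ≤ 2 ^ n := pow_le_pow_right₀ (by norm_num) hj
        gcongr
    _ = _ := by ring

theorem continuous_oscillatory_integrand {m : ℝ} {W : Set E} (hW : IsOpen W) {H : E → ℝ}
    (hH : ContDiffOn ℝ ∞ H W) {A : E × ℝ → ℂ} (hA : IsSymbol m W A) {f : E → ℂ}
    (hf : Continuous f) (hfW : tsupport f ⊆ W) :
    Continuous fun p : E × ℝ => oscFactor H p.2 p.1 * (A p * f p.1) := by
  have h1 : ContinuousOn (fun p : E × ℝ => oscFactor H p.2 p.1 * A p) (W ×ˢ univ) := by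
    have h2 : ContinuousOn (fun p : E × ℝ => H p.1) (W ×ˢ univ) :=
      hH.continuousOn.comp continuousOn_fst fun p hp => hp.1
    have h3 : ContinuousOn (fun p : E × ℝ => (H p.1 : ℂ)) (W ×ˢ univ) :=
      Complex.continuous_ofReal.comp_continuousOn h2
    have h4 : ContinuousOn (fun p : E × ℝ => (p.2 : ℂ)) (W ×ˢ univ) :=
      Complex.continuous_ofReal.comp_continuousOn continuousOn_snd
    exact ((continuousOn_const.mul h4).mul h3).neg.cexp.mul hA.1.continuousOn
  have h3 : tsupport (fun p : E × ℝ => f p.1) ⊆ W ×ˢ univ := fun p hp =>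
    ⟨hfW (tsupport_comp_subset_preimage f continuous_fst hp), mem_univ _⟩
  simpa only [mul_assoc] using
    continuous_mul_of_tsupport_subset (f := fun p : E × ℝ => f p.1)
      (hW.prod isOpen_univ) h1 (hf.comp continuous_fst) h3

variable [MeasureSpace E] [BorelSpace E] [(volume : Measure E).IsAddHaarMeasure]
  [FiniteDimensional ℝ E]

/-- Each integration by parts along `e` gains a factor `|w|` and costs one derivative of `A f`,
which leaves the symbol order `m` unchanged. -/
theorem exists_norm_fibreIntegral_le {m : ℝ} {W : Set E} (hW : IsOpen W) {H : E → ℝ}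
    (hH : ContDiffOn ℝ ∞ H W) {e : E} (he : ∀ x ∈ W, fderiv ℝ H x e = 1)
    {A : E × ℝ → ℂ} (hA : IsSymbol m W A) {K : Set E} (hK : IsCompact K) (hKW : K ⊆ W) (n : ℕ) :
    ∃ C : ℝ, 0 ≤ C ∧ ∀ (f : E → ℂ) (B : ℝ), ContDiff ℝ ∞ f → tsupport f ⊆ K →
      (∀ i ≤ n, ∀ x, ‖iteratedFDeriv ℝ i f x‖ ≤ B) →
        ∀ w : ℝ, ‖fibreIntegral H A f w‖ ≤ C * B * (1 + ‖w‖) ^ (m - n) := by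
  obtain ⟨C, hC0, hC⟩ := exists_norm_iteratedFDeriv_symbol_mul_le hW hA hK hKW n
  refine ⟨2 ^ n * (C * volume.real K) * (1 + ‖e‖ ^ n), by positivity,
    fun f B hf hfK hB w => ?_⟩
  have hB0 : 0 ≤ B := (norm_nonneg _).trans (hB 0 (Nat.zero_le _) 0)
  set u : E → ℂ := fun x => A (x, w) * f x with hu
  have huf : tsupport u ⊆ tsupport f := closure_mono (Function.support_mul_subset_right _ f)
  have husm : ContDiff ℝ ∞ u :=
    contDiff_mul_of_tsupport_subset hW (hA.contDiffOn_base w) hf (hfK.trans hKW)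
  have huc : HasCompactSupport u := hK.of_isClosed_subset (isClosed_tsupport _) (huf.trans hfK)
  -- Only `j = 0` and `j = n` are used: the first controls small `w`, the second large `w`.
  have key : ∀ j ≤ n, ‖w‖ ^ j * ‖fibreIntegral H A f w‖
      ≤ C * B * (1 + ‖w‖) ^ m * ‖e‖ ^ j * volume.real K := by
    intro j hj
    have h1 := integral_oscFactor_mul_iteratedFDeriv hW hH he w husm huc
      ((huf.trans hfK).trans hKW) j
    have h2 : ‖w‖ ^ j * ‖fibreIntegral H A f w‖
        = ‖∫ x, oscFactor H w x * iteratedFDeriv ℝ j u x (fun _ => e)‖ := by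
      rw [h1, norm_mul, norm_pow, norm_mul, Complex.norm_I, one_mul, Complex.norm_real]
      rfl
    rw [h2, ← setIntegral_eq_integral_of_forall_compl_eq_zero (s := K)]
    · refine norm_setIntegral_le_of_norm_le_const hK.measure_lt_top fun x hx => ?_
      rw [norm_mul, norm_oscFactor, one_mul]
      refine (ContinuousMultilinearMap.le_opNorm _ _).trans ?_
      rw [Finset.prod_const, Finset.card_univ, Fintype.card_fin]
      gcongr
      exact hC f B hf hB j hj x hx w
    · intro x hx
      have h3 : x ∉ tsupport (iteratedFDeriv ℝ j u) := fun h =>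
        hx (hfK (huf (tsupport_iteratedFDeriv_subset j h)))
      rw [image_eq_zero_of_notMem_tsupport h3]
      simp
  have k0 := key 0 (Nat.zero_le _)
  have kn := key n le_rfl
  rw [pow_zero, one_mul, pow_zero, mul_one] at k0
  have hpos : (0 : ℝ) < 1 + ‖w‖ := by positivity
  -- Combines the two estimates into a bound in powers of `1 + ‖w‖`, the form in which symbol bounds
  -- are stated.
  have hp : (1 + ‖w‖) ^ n ≤ 2 ^ n * (1 + ‖w‖ ^ n) := by
    refine (add_pow_le zero_le_one (norm_nonneg w) n).trans ?_
    rw [one_pow]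
    gcongr
    · norm_num
    · exact Nat.sub_le _ _
  rw [Real.rpow_sub hpos, Real.rpow_natCast, ← mul_div_assoc, le_div_iff₀ (by positivity)]
  calc ‖fibreIntegral H A f w‖ * (1 + ‖w‖) ^ n
      ≤ ‖fibreIntegral H A f w‖ * (2 ^ n * (1 + ‖w‖ ^ n)) := by gcongr
    _ = 2 ^ n * (‖fibreIntegral H A f w‖ + ‖w‖ ^ n * ‖fibreIntegral H A f w‖) := by ring
    _ ≤ 2 ^ n * (C * B * (1 + ‖w‖) ^ m * volume.real K
          + C * B * (1 + ‖w‖) ^ m * ‖e‖ ^ n * volume.real K) := by gcongr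
    _ = _ := by ring

theorem stronglyMeasurable_fibreIntegral {m : ℝ} {W : Set E} (hW : IsOpen W) {H : E → ℝ}
    (hH : ContDiffOn ℝ ∞ H W) {A : E × ℝ → ℂ} (hA : IsSymbol m W A) {f : E → ℂ}
    (hf : Continuous f) (hfW : tsupport f ⊆ W) : StronglyMeasurable (fibreIntegral H A f) := by
  have : SecondCountableTopology E := secondCountable_of_proper
  exact (continuous_oscillatory_integrand hW hH hA hf hfW).stronglyMeasurable.integral_prod_left'

theorem exists_norm_oscPairing_le {m : ℝ} {W : Set E} (hW : IsOpen W) {H : E → ℝ}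
    (hH : ContDiffOn ℝ ∞ H W) {e : E} (he : ∀ x ∈ W, fderiv ℝ H x e = 1)
    {A : E × ℝ → ℂ} (hA : IsSymbol m W A) {K : Set E} (hK : IsCompact K) (hKW : K ⊆ W) :
    ∃ (n : ℕ) (C : ℝ), 0 ≤ C ∧ ∀ (f : E → ℂ) (B : ℝ), ContDiff ℝ ∞ f → tsupport f ⊆ K →
      (∀ i ≤ n, ∀ x, ‖iteratedFDeriv ℝ i f x‖ ≤ B) →
        Integrable (fibreIntegral H A f) ∧ ‖oscPairing H A f‖ ≤ C * B := by
  -- With `n - m > 1` the weight `(1 + |w|) ^ (m - n)` is integrable on the line.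
  obtain ⟨n, hn⟩ := exists_nat_gt (m + 1)
  obtain ⟨C, hC0, hC⟩ := exists_norm_fibreIntegral_le hW hH he hA hK hKW n
  have hint : Integrable fun w : ℝ => (1 + ‖w‖) ^ (m - n) := by
    have h := integrable_one_add_norm (E := ℝ) (μ := volume) (r := n - m) (by simp; linarith)
    simpa using h
  refine ⟨n, C * ∫ w : ℝ, (1 + ‖w‖) ^ (m - n), by positivity, fun f B hf hfK hB => ?_⟩
  have hb := hC f B hf hfK hB
  refine ⟨(hint.const_mul (C * B)).mono'
    (stronglyMeasurable_fibreIntegral hW hH hA hf.continuous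
      (hfK.trans hKW)).aestronglyMeasurable (Eventually.of_forall hb), ?_⟩
  refine (norm_integral_le_of_norm_le (hint.const_mul (C * B)) (Eventually.of_forall hb)).trans ?_
  rw [integral_const_mul]
  exact le_of_eq (by ring)

theorem integrable_fibreIntegral {m : ℝ} {W : Set E} (hW : IsOpen W) {H : E → ℝ}
    (hH : ContDiffOn ℝ ∞ H W) {e : E} (he : ∀ x ∈ W, fderiv ℝ H x e = 1)
    {A : E × ℝ → ℂ} (hA : IsSymbol m W A) {f : E → ℂ} (hf : ContDiff ℝ ∞ f)
    (hc : HasCompactSupport f) (hfW : tsupport f ⊆ W) : Integrable (fibreIntegral H A f) := by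
  obtain ⟨n, C, -, h⟩ := exists_norm_oscPairing_le hW hH he hA hc hfW
  obtain ⟨B, -, hB⟩ := exists_norm_iteratedFDeriv_le hf hc n
  exact (h f B hf subset_rfl hB).1

theorem oscPairing_add {m : ℝ} {W : Set E} (hW : IsOpen W) {H : E → ℝ}
    (hH : ContDiffOn ℝ ∞ H W) {e : E} (he : ∀ x ∈ W, fderiv ℝ H x e = 1)
    {A : E × ℝ → ℂ} (hA : IsSymbol m W A) {f g : E → ℂ} (hf : ContDiff ℝ ∞ f)
    (hfc : HasCompactSupport f) (hfW : tsupport f ⊆ W) (hg : ContDiff ℝ ∞ g)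
    (hgc : HasCompactSupport g) (hgW : tsupport g ⊆ W) :
    oscPairing H A (fun x => f x + g x) = oscPairing H A f + oscPairing H A g := by
  unfold oscPairing
  rw [← integral_add (integrable_fibreIntegral hW hH he hA hf hfc hfW)
    (integrable_fibreIntegral hW hH he hA hg hgc hgW)]
  congr 1
  funext w
  have hI : ∀ {f : E → ℂ}, ContDiff ℝ ∞ f → HasCompactSupport f → tsupport f ⊆ W →
      Integrable fun x => oscFactor H w x * (A (x, w) * f x) := fun {f} hf hfc hfW =>
    integrable_oscFactor_mul hW hH w
      (contDiff_mul_of_tsupport_subset hW (hA.contDiffOn_base w) hf hfW).continuous hfc.mul_left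
      ((closure_mono (Function.support_mul_subset_right _ f)).trans hfW)
  unfold fibreIntegral
  rw [← integral_add (hI hf hfc hfW) (hI hg hgc hgW)]
  congr 1
  funext x
  ring

theorem integrable_cutoff_mul {m : ℝ} {W : Set E} (hW : IsOpen W) {H : E → ℝ}
    (hH : ContDiffOn ℝ ∞ H W) {A : E × ℝ → ℂ} (hA : IsSymbol m W A) {f : E → ℂ}
    (hf : Continuous f) (hc : HasCompactSupport f) (hfW : tsupport f ⊆ W) {ρ : ℝ → ℂ}
    (hρ : Continuous ρ) (hρc : HasCompactSupport ρ) :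
    Integrable (fun p : E × ℝ => ρ p.2 * (oscFactor H p.2 p.1 * (A p * f p.1)))
      (volume.prod volume) := by
  have : SecondCountableTopology E := secondCountable_of_proper
  refine ((hρ.comp continuous_snd).mul
    (continuous_oscillatory_integrand hW hH hA hf hfW)).integrable_of_hasCompactSupport ?_
  refine HasCompactSupport.intro (hc.isCompact.prod hρc.isCompact) fun p hp => ?_
  by_cases h : p.1 ∈ tsupport f
  · have h2 : p.2 ∉ tsupport ρ := fun h2 => hp ⟨h, h2⟩
    simp [image_eq_zero_of_notMem_tsupport h2]
  · simp [image_eq_zero_of_notMem_tsupport h]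

/-- Fubini applies because the cutoff makes the integrand continuous with compact support; without
it the double integral need not converge absolutely. -/
theorem integral_integral_cutoff_mul {m : ℝ} {W : Set E} (hW : IsOpen W) {H : E → ℝ}
    (hH : ContDiffOn ℝ ∞ H W) {A : E × ℝ → ℂ} (hA : IsSymbol m W A) {f : E → ℂ}
    (hf : Continuous f) (hc : HasCompactSupport f) (hfW : tsupport f ⊆ W) {ρ : ℝ → ℂ}
    (hρ : Continuous ρ) (hρc : HasCompactSupport ρ) :
    ∫ x, ∫ w, ρ w * (oscFactor H w x * (A (x, w) * f x)) = ∫ w, ρ w * fibreIntegral H A f w := by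
  have : SecondCountableTopology E := secondCountable_of_proper
  rw [integral_integral_swap (integrable_cutoff_mul hW hH hA hf hc hfW hρ hρc)]
  congr 1
  funext w
  rw [integral_const_mul]
  rfl

end OscillatoryPairing

/-! ### Removal of the cutoff. -/

section Cutoff

theorem IsCutoff.continuous_scaled {χ : ℝ → ℝ} (hχ : IsCutoff χ) (ε : ℝ) :
    Continuous fun w : ℝ => (χ (ε * w) : ℂ) :=
  Complex.continuous_ofReal.comp (hχ.smooth.continuous.comp (continuous_const.mul continuous_id))

theorem IsCutoff.hasCompactSupport_scaled {χ : ℝ → ℝ} (hχ : IsCutoff χ) {ε : ℝ} (hε : 0 < ε) :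
    HasCompactSupport fun w : ℝ => (χ (ε * w) : ℂ) :=
  (hχ.compact.comp_homeomorph (Homeomorph.mulLeft₀ ε hε.ne')).comp_left
    (g := Complex.ofReal) Complex.ofReal_zero

/-- Dominated convergence: `χ` is bounded, and for fixed `w` the value `χ (ε w)` equals `1` once `ε`
is small. The limit therefore does not depend on `χ`. -/
theorem IsCutoff.tendsto_integral {χ : ℝ → ℝ} (hχ : IsCutoff χ) {G : ℝ → ℂ} (hG : Integrable G) :
    Tendsto (fun ε : ℝ => ∫ w, (χ (ε * w) : ℂ) * G w) (𝓝[>] 0) (𝓝 (∫ w, G w)) := by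
  obtain ⟨M, hM⟩ := hχ.smooth.continuous.bounded_above_of_compact_support hχ.compact
  refine tendsto_integral_filter_of_dominated_convergence (fun w => M * ‖G w‖) ?_ ?_
    (hG.norm.const_mul M) ?_
  · exact Eventually.of_forall fun ε =>
      (hχ.continuous_scaled ε).aestronglyMeasurable.mul hG.aestronglyMeasurable
  · refine Eventually.of_forall fun ε => Eventually.of_forall fun w => ?_
    rw [norm_mul, Complex.norm_real]
    exact mul_le_mul_of_nonneg_right (hM _) (norm_nonneg _)
  · refine Eventually.of_forall fun w => ?_
    have h1 : Tendsto (fun ε : ℝ => ε * w) (𝓝[>] 0) (𝓝 0) := by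
      have : Tendsto (fun ε : ℝ => ε * w) (𝓝 0) (𝓝 (0 * w)) :=
        (continuous_id.mul continuous_const).tendsto 0
      rw [zero_mul] at this
      exact this.mono_left nhdsWithin_le_nhds
    refine tendsto_const_nhds.congr' ?_
    filter_upwards [h1.eventually hχ.eq_one] with ε hε
    simp [hε]

end Cutoff

/-! ### Distributions from seminorm estimates. -/

section Distributions

variable {E : Type*} [NormedAddCommGroup E] [NormedSpace ℝ E]

/-- A linear functional on test functions that is bounded, on the test functions with support in a
given compact set, by finitely many derivatives, is a distribution. -/
def distributionOfBound {Ω : Opens E} (L : 𝓓(Ω, ℝ) →ₗ[ℝ] ℂ)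
    (h : ∀ K : Set E, IsCompact K → K ⊆ Ω → ∃ (n : ℕ) (C : ℝ), 0 ≤ C ∧ ∀ (f : 𝓓(Ω, ℝ)) (B : ℝ),
      tsupport f ⊆ K → (∀ i ≤ n, ∀ x, ‖iteratedFDeriv ℝ i f x‖ ≤ B) → ‖L f‖ ≤ C * B) :
    𝓓'(Ω, ℂ) :=
  TestFunction.mkCLM ℝ L L.map_add L.map_smul (by
    intro K hK
    obtain ⟨n, C, hC0, hC⟩ := h K K.isCompact hK
    -- Continuity is tested on each space of functions supported in `K`; the bound `B` is taken to
    -- be the supremum of the seminorms of order at most `n`.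
    let T : 𝓓_{K}(E, ℝ) →L[ℝ] ℂ := ContDiffMapSupportedIn.mkCLMtoNormedSpace ℝ
      (fun f => L (TestFunction.ofSupportedIn hK f))
      (fun f g => L.map_add (TestFunction.ofSupportedIn hK f) (TestFunction.ofSupportedIn hK g))
      (fun c f => L.map_smul c (TestFunction.ofSupportedIn hK f))
      ⟨Finset.range (n + 1), C, hC0, fun f => hC _ _ f.tsupport_subset fun i hi x =>
        (ContDiffMapSupportedIn.norm_iteratedFDeriv_apply_le_seminorm ℝ (by exact_mod_cast le_top)
          (f := f)).trans (Seminorm.le_finset_sup_apply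
            (Finset.mem_range.2 (Nat.lt_succ_of_le hi)))⟩
    exact T.continuous)

end Distributions

/-! ### Linear phases and the conormal bundle of a hypersurface. -/

section ConormalBundle

variable {E : Type*} [NormedAddCommGroup E] [NormedSpace ℝ E]
variable {Θ : Type*} [NormedAddCommGroup Θ] [NormedSpace ℝ Θ]

/-- The conormal bundle, without its zero section, of the hypersurface `{H = 0}` of `W`. -/
def conormalBundle (W : Set E) (H : E → ℝ) : Set (E × (E →L[ℝ] ℝ)) :=
  {q | q.1 ∈ W ∧ H q.1 = 0 ∧ ∃ r : ℝ, r ≠ 0 ∧ q.2 = r • fderiv ℝ H q.1}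

/-- The phase function `ℓ θ * H x`, linear in the one-dimensional phase variable. -/
def linearPhase (H : E → ℝ) (ℓ : Θ ≃L[ℝ] ℝ) (p : E × Θ) : ℝ := ℓ p.2 * H p.1

variable {W : Set E} {H : E → ℝ} {e : E}

theorem hasFDerivAt_of_contDiffOn (hW : IsOpen W) (hH : ContDiffOn ℝ ∞ H W) {x : E} (hx : x ∈ W) :
    HasFDerivAt H (fderiv ℝ H x) x :=
  ((hH.contDiffAt (hW.mem_nhds hx)).differentiableAt (by simp)).hasFDerivAt

theorem hasFDerivAt_linearPhase (hW : IsOpen W) (hH : ContDiffOn ℝ ∞ H W) (ℓ : Θ ≃L[ℝ] ℝ)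
    {p : E × Θ} (hp : p.1 ∈ W) :
    HasFDerivAt (linearPhase H ℓ)
      (ℓ p.2 • (fderiv ℝ H p.1).comp (ContinuousLinearMap.fst ℝ E Θ)
        + H p.1 • (ℓ : Θ →L[ℝ] ℝ).comp (ContinuousLinearMap.snd ℝ E Θ)) p := by
  have h1 : HasFDerivAt (fun p : E × Θ => H p.1)
      ((fderiv ℝ H p.1).comp (ContinuousLinearMap.fst ℝ E Θ)) p :=
    (hasFDerivAt_of_contDiffOn hW hH hp).comp p hasFDerivAt_fst
  have h2 : HasFDerivAt (fun p : E × Θ => ℓ p.2)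
      ((ℓ : Θ →L[ℝ] ℝ).comp (ContinuousLinearMap.snd ℝ E Θ)) p :=
    ℓ.hasFDerivAt.comp p hasFDerivAt_snd
  exact h2.mul h1

theorem dBase_linearPhase (hW : IsOpen W) (hH : ContDiffOn ℝ ∞ H W) (ℓ : Θ ≃L[ℝ] ℝ)
    {p : E × Θ} (hp : p.1 ∈ W) : dBase (linearPhase H ℓ) p = ℓ p.2 • fderiv ℝ H p.1 := by
  rw [dBase, (hasFDerivAt_linearPhase hW hH ℓ hp).fderiv]
  ext v
  simp

theorem dFibre_linearPhase (hW : IsOpen W) (hH : ContDiffOn ℝ ∞ H W) (ℓ : Θ ≃L[ℝ] ℝ)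
    {p : E × Θ} (hp : p.1 ∈ W) : dFibre (linearPhase H ℓ) p = H p.1 • (ℓ : Θ →L[ℝ] ℝ) := by
  rw [dFibre, (hasFDerivAt_linearPhase hW hH ℓ hp).fderiv]
  ext v
  simp

theorem dFibre_linearPhase_eq_zero_iff (hW : IsOpen W) (hH : ContDiffOn ℝ ∞ H W) (ℓ : Θ ≃L[ℝ] ℝ)
    {p : E × Θ} (hp : p.1 ∈ W) : dFibre (linearPhase H ℓ) p = 0 ↔ H p.1 = 0 := by
  rw [dFibre_linearPhase hW hH ℓ hp]
  refine ⟨fun h => ?_, fun h => by rw [h, zero_smul]⟩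
  simpa using congrArg (fun L : Θ →L[ℝ] ℝ => L (ℓ.symm 1)) h

theorem isNondegeneratePhase_linearPhase (hW : IsOpen W) (hH : ContDiffOn ℝ ∞ H W)
    (he : ∀ x ∈ W, fderiv ℝ H x e = 1) (ℓ : Θ ≃L[ℝ] ℝ) :
    IsNondegeneratePhase (W ×ˢ {θ : Θ | θ ≠ 0}) (linearPhase H ℓ) where
  isOpen := hW.prod isOpen_ne
  ne_zero p hp := hp.2
  conic p hp r hr := ⟨hp.1, smul_ne_zero hr.ne' hp.2⟩
  smooth := (ℓ.contDiff.comp contDiff_snd).contDiffOn.mul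
    (hH.comp contDiff_fst.contDiffOn fun p hp => hp.1)
  homogeneous p _ r _ := by
    simp [linearPhase, mul_assoc]
  fderiv_ne_zero p hp h := by
    have h1 := congrArg (fun L : E × Θ →L[ℝ] ℝ => L (e, 0)) h
    rw [(hasFDerivAt_linearPhase hW hH ℓ hp.1).fderiv] at h1
    simp [he p.1 hp.1] at h1
    exact hp.2 h1
  nondegenerate p hp _ := by
    have h1 : dFibre (linearPhase H ℓ) =ᶠ[𝓝 p] fun p => H p.1 • (ℓ : Θ →L[ℝ] ℝ) := by
      filter_upwards [(hW.preimage continuous_fst).mem_nhds hp.1] with q hq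
      exact dFibre_linearPhase hW hH ℓ hq
    have h2 : HasFDerivAt (fun p : E × Θ => H p.1)
        ((fderiv ℝ H p.1).comp (ContinuousLinearMap.fst ℝ E Θ)) p :=
      (hasFDerivAt_of_contDiffOn hW hH hp.1).comp p hasFDerivAt_fst
    rw [h1.fderiv_eq, (h2.smul_const (ℓ : Θ →L[ℝ] ℝ)).fderiv]
    intro m
    -- The derivative of `φ_θ` along `e` is `ℓ`, and every covector `m` on the line `Θ` is `m (ℓ⁻¹
    -- 1)` times `ℓ`.
    refine ⟨(m (ℓ.symm 1) • e, 0), ?_⟩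
    ext v
    have h3 : v = ℓ v • ℓ.symm 1 := by
      apply ℓ.injective
      simp
    conv_rhs => rw [h3, map_smul]
    simp [he p.1 hp.1, mul_comm]

theorem lagrangianMap_image_linearPhase (hW : IsOpen W) (hH : ContDiffOn ℝ ∞ H W)
    (ℓ : Θ ≃L[ℝ] ℝ) :
    lagrangianMap (linearPhase H ℓ) '' criticalSet (W ×ˢ {θ : Θ | θ ≠ 0}) (linearPhase H ℓ)
      = conormalBundle W H := by
  ext q
  constructor
  · rintro ⟨p, ⟨hp, hp0⟩, rfl⟩
    exact ⟨hp.1, (dFibre_linearPhase_eq_zero_iff hW hH ℓ hp.1).1 hp0, ℓ p.2,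
      (map_ne_zero_iff ℓ ℓ.injective).2 hp.2, dBase_linearPhase hW hH ℓ hp.1⟩
  · rintro ⟨hqW, hq0, r, hr, hq⟩
    refine ⟨(q.1, ℓ.symm r), ⟨⟨hqW, (map_ne_zero_iff ℓ.symm ℓ.symm.injective).2 hr⟩,
      (dFibre_linearPhase_eq_zero_iff hW hH ℓ (p := (q.1, ℓ.symm r)) hqW).2 hq0⟩, ?_⟩
    refine Prod.ext rfl ?_
    rw [lagrangianMap, dBase_linearPhase hW hH ℓ (p := (q.1, ℓ.symm r)) hqW, hq]
    simp

theorem parametrizesOpenPart_linearPhase (hW : IsOpen W) (hH : ContDiffOn ℝ ∞ H W)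
    (he : ∀ x ∈ W, fderiv ℝ H x e = 1) (ℓ : Θ ≃L[ℝ] ℝ) :
    ParametrizesOpenPart (W ×ˢ {θ : Θ | θ ≠ 0}) (linearPhase H ℓ) (conormalBundle W H) := by
  -- Evaluating the covector `ℓ θ • dH` at `e` returns `ℓ θ`, so the inverse is smooth and global.
  refine ⟨W ×ˢ univ, fun q => (q.1, ℓ.symm (q.2 e)), hW.prod isOpen_univ, ?_, ?_, ?_⟩
  · exact (contDiff_fst.prodMk (ℓ.symm.contDiff.comp
      (contDiff_snd.clm_apply contDiff_const))).contDiffOn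
  · rw [lagrangianMap_image_linearPhase hW hH ℓ]
    have hsub : conormalBundle W H ⊆ W ×ˢ univ := fun q hq => ⟨hq.1, mem_univ _⟩
    exact (inter_eq_left.2 hsub).symm
  · intro p hp
    refine Prod.ext rfl ?_
    simp [lagrangianMap, dBase_linearPhase hW hH ℓ hp.1.1, he p.1 hp.1.1]

/-- A defining function, with values in `E`, of the conormal bundle of `{H = 0}`. The isomorphism
`J` identifies covectors with vectors. -/
def conormalDefining (H : E → ℝ) (e : E) (J : (E →L[ℝ] ℝ) ≃L[ℝ] E) (q : E × (E →L[ℝ] ℝ)) : E :=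
  H q.1 • e + J (q.2 - q.2 e • fderiv ℝ H q.1)

theorem contDiffOn_conormalDefining (hW : IsOpen W) (hH : ContDiffOn ℝ ∞ H W)
    (J : (E →L[ℝ] ℝ) ≃L[ℝ] E) :
    ContDiffOn ℝ ∞ (conormalDefining H e J) (W ×ˢ univ) := by
  have h1 : ContDiffOn ℝ ∞ (fun q : E × (E →L[ℝ] ℝ) => H q.1) (W ×ˢ univ) :=
    hH.comp contDiff_fst.contDiffOn fun p hp => hp.1
  have h2 : ContDiffOn ℝ ∞ (fun q : E × (E →L[ℝ] ℝ) => fderiv ℝ H q.1) (W ×ˢ univ) :=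
    (hH.fderiv_of_isOpen (m := ∞) hW (by simp)).comp contDiff_fst.contDiffOn fun p hp => hp.1
  have h3 : ContDiff ℝ ∞ fun q : E × (E →L[ℝ] ℝ) => q.2 e :=
    contDiff_snd.clm_apply contDiff_const
  exact (h1.smul contDiffOn_const).add
    (J.contDiff.comp_contDiffOn (contDiffOn_snd.sub (h3.contDiffOn.smul h2)))

/-- The covector `q.2 - q.2 e • dH` annihilates `e`, so its image under `J` lies in the kernel of
`e'`. Applying `e'` therefore isolates the equation `H = 0`, and the remaining part gives
proportionality to `dH`. -/
theorem conormalDefining_eq_zero_iff (he : ∀ x ∈ W, fderiv ℝ H x e = 1)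
    {J : (E →L[ℝ] ℝ) ≃L[ℝ] E} {e' : E →L[ℝ] ℝ} (he' : e' e = 1) (hJ : ∀ η, e' (J η) = η e)
    {q : E × (E →L[ℝ] ℝ)} (hq : q.1 ∈ W) :
    conormalDefining H e J q = 0 ↔ H q.1 = 0 ∧ q.2 = q.2 e • fderiv ℝ H q.1 := by
  constructor
  · intro h
    have h1 := congrArg e' h
    simp only [conormalDefining, map_add, map_smul, he', hJ, map_zero] at h1
    simp [he q.1 hq] at h1
    rw [conormalDefining, h1, zero_smul, zero_add, map_eq_zero_iff J J.injective, sub_eq_zero] at h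
    exact ⟨h1, h⟩
  · rintro ⟨h1, h2⟩
    rw [conormalDefining, h1, ← h2, sub_self, map_zero, zero_smul, add_zero]

theorem mem_conormalBundle_iff (he : ∀ x ∈ W, fderiv ℝ H x e = 1) {q : E × (E →L[ℝ] ℝ)} :
    q ∈ conormalBundle W H ↔
      q.1 ∈ W ∧ H q.1 = 0 ∧ q.2 e ≠ 0 ∧ q.2 = q.2 e • fderiv ℝ H q.1 := by
  constructor
  · rintro ⟨h1, h2, r, hr, h3⟩
    have h4 : q.2 e = r := by rw [h3]; simp [he q.1 h1]
    exact ⟨h1, h2, h4 ▸ hr, h4 ▸ h3⟩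
  · rintro ⟨h1, h2, h3, h4⟩
    exact ⟨h1, h2, _, h3, h4⟩

theorem fderiv_conormalDefining_apply (hW : IsOpen W) (hH : ContDiffOn ℝ ∞ H W)
    (J : (E →L[ℝ] ℝ) ≃L[ℝ] E) {q : E × (E →L[ℝ] ℝ)} (hq : q.1 ∈ W) (a : E × (E →L[ℝ] ℝ)) :
    fderiv ℝ (conormalDefining H e J) q a = fderiv ℝ H q.1 a.1 • e
      + J (a.2 - (q.2 e • fderiv ℝ (fderiv ℝ H) q.1 a.1 + a.2 e • fderiv ℝ H q.1)) := by
  have h1 : HasFDerivAt (fun q : E × (E →L[ℝ] ℝ) => H q.1)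
      ((fderiv ℝ H q.1).comp (ContinuousLinearMap.fst ℝ E (E →L[ℝ] ℝ))) q :=
    (hasFDerivAt_of_contDiffOn hW hH hq).comp q hasFDerivAt_fst
  have h2 : HasFDerivAt (fun q : E × (E →L[ℝ] ℝ) => fderiv ℝ H q.1)
      ((fderiv ℝ (fderiv ℝ H) q.1).comp (ContinuousLinearMap.fst ℝ E (E →L[ℝ] ℝ))) q :=
    HasFDerivAt.comp q ((((hH.fderiv_of_isOpen (m := ∞) hW (by simp)).contDiffAt
      (hW.mem_nhds hq)).differentiableAt (by simp)).hasFDerivAt) hasFDerivAt_fst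
  have h3 : HasFDerivAt (fun q : E × (E →L[ℝ] ℝ) => q.2 e)
      ((ContinuousLinearMap.apply ℝ ℝ e).comp (ContinuousLinearMap.snd ℝ E (E →L[ℝ] ℝ))) q :=
    (ContinuousLinearMap.apply ℝ ℝ e).hasFDerivAt.comp q hasFDerivAt_snd
  have h4 := (h1.smul_const e).add (J.hasFDerivAt.comp q (hasFDerivAt_snd.sub (h3.smul h2)))
  change fderiv ℝ (fun q : E × (E →L[ℝ] ℝ) => H q.1 • e + J (q.2 - q.2 e • fderiv ℝ H q.1)) q a = _
  erw [h4.fderiv]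
  simp

/-- The function `dH(e)` is constant on `W`, so its derivative vanishes. -/
theorem fderiv_fderiv_apply_eq_zero (hW : IsOpen W) (hH : ContDiffOn ℝ ∞ H W)
    (he : ∀ x ∈ W, fderiv ℝ H x e = 1) {x : E} (hx : x ∈ W) (v : E) :
    fderiv ℝ (fderiv ℝ H) x v e = 0 := by
  have h1 : HasFDerivAt (fderiv ℝ H) (fderiv ℝ (fderiv ℝ H) x) x :=
    ((((hH.fderiv_of_isOpen (m := ∞) hW (by simp)).contDiffAt
      (hW.mem_nhds hx)).differentiableAt (by simp)).hasFDerivAt)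
  have h2 : HasFDerivAt (fun x => fderiv ℝ H x e)
      ((ContinuousLinearMap.apply ℝ ℝ e).comp (fderiv ℝ (fderiv ℝ H) x)) x :=
    (ContinuousLinearMap.apply ℝ ℝ e).hasFDerivAt.comp x h1
  have h3 : HasFDerivAt (fun x => fderiv ℝ H x e) (0 : E →L[ℝ] ℝ) x := by
    refine (hasFDerivAt_const (1 : ℝ) x).congr_of_eventuallyEq ?_
    filter_upwards [hW.mem_nhds hx] with y hy using he y hy
  exact congrArg (fun L : E →L[ℝ] ℝ => L v) (h2.unique h3)

/-- A tangent vector `(a₁, a₂)` satisfies `dH(a₁) = 0` and `a₂ = r D²H(a₁) + a₂(e) dH`, where `r =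
q.2 e`. The symplectic form of two such vectors is `r` times the antisymmetric part of `D²H`, hence
zero. -/
theorem isConicLagrangian_conormalBundle (hW : IsOpen W) (hH : ContDiffOn ℝ ∞ H W)
    (he : ∀ x ∈ W, fderiv ℝ H x e = 1) (J : (E →L[ℝ] ℝ) ≃L[ℝ] E) {e' : E →L[ℝ] ℝ}
    (he' : e' e = 1) (hJ : ∀ η, e' (J η) = η e) :
    IsConicLagrangian W (conormalBundle W H) where
  subset q hq := by
    obtain ⟨h1, -, h3, -⟩ := (mem_conormalBundle_iff he).1 hq
    exact ⟨h1, fun h => h3 (by rw [h]; rfl)⟩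
  closed := by
    -- The defining function is continuous over all of `W`, so its zero set is relatively closed. On
    -- that set `q.2 = q.2 e • dH`, so a nonzero covector automatically has `q.2 e ≠ 0`.
    obtain ⟨Z, hZ, hZe⟩ := continuousOn_iff_isClosed.1
      (contDiffOn_conormalDefining (e := e) hW hH J).continuousOn {0} isClosed_singleton
    refine ⟨Z, hZ, ?_⟩
    ext q
    have hq := Set.ext_iff.1 hZe q
    rw [mem_conormalBundle_iff he]
    constructor
    · rintro ⟨h1, h2, h3, h4⟩
      exact ⟨(hq.1 ⟨(conormalDefining_eq_zero_iff he he' hJ h1).2 ⟨h2, h4⟩,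
        ⟨h1, mem_univ _⟩⟩).1, h1, fun h => h3 (by rw [h]; rfl)⟩
    · rintro ⟨h1, h2, h3⟩
      obtain ⟨h4, h5⟩ := (conormalDefining_eq_zero_iff he he' hJ h2).1
        (hq.2 ⟨h1, ⟨h2, mem_univ _⟩⟩).1
      exact ⟨h2, h4, fun h => h3 (by rw [h5, h, zero_smul]), h5⟩
  conic := by
    rintro q ⟨h1, h2, r, hr, h3⟩ c hc
    exact ⟨h1, h2, c * r, mul_ne_zero hc.ne' hr, by rw [h3, smul_smul]⟩
  lagrangian p hp := by
    have hO : IsOpen {q : E × (E →L[ℝ] ℝ) | q.1 ∈ W ∧ q.2 e ≠ 0} :=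
      (hW.preimage continuous_fst).inter
        (isOpen_ne.preimage (continuous_snd.clm_apply continuous_const))
    have hp' := (mem_conormalBundle_iff he).1 hp
    refine ⟨{q | q.1 ∈ W ∧ q.2 e ≠ 0}, conormalDefining H e J, hO, ⟨hp'.1, hp'.2.2.1⟩,
      (contDiffOn_conormalDefining hW hH J).mono fun q hq => ⟨hq.1, mem_univ _⟩, ?_, ?_⟩
    · ext q
      constructor
      · rintro ⟨h, hqO⟩
        have h' := (mem_conormalBundle_iff he).1 h
        exact ⟨hqO, (conormalDefining_eq_zero_iff he he' hJ hqO.1).2 ⟨h'.2.1, h'.2.2.2⟩⟩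
      · rintro ⟨hqO, h⟩
        have h' := (conormalDefining_eq_zero_iff he he' hJ hqO.1).1 h
        exact ⟨(mem_conormalBundle_iff he).2 ⟨hqO.1, h'.1, hqO.2, h'.2⟩, hqO⟩
    · rintro q ⟨-, hqW, -⟩
      have hdd := fun v => fderiv_fderiv_apply_eq_zero hW hH he hqW v
      refine ⟨fun y => ?_, fun a b ha hb => ?_⟩
      · set ζ : E →L[ℝ] ℝ := J.symm (y - e' y • e) with hζ
        have hζe : ζ e = 0 := by
          rw [← hJ, hζ, J.apply_symm_apply]
          simp [he']
        -- The base component produces the part of `y` along `e`, and `ζ` the part in the kernel of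
        -- `e'`. The added Hessian term cancels the one in the derivative; both covectors vanish at
        -- `e`, so the last term drops out.
        refine ⟨(e' y • e, ζ + q.2 e • fderiv ℝ (fderiv ℝ H) q.1 (e' y • e)), ?_⟩
        rw [fderiv_conormalDefining_apply hW hH J hqW]
        have h1 : (ζ + q.2 e • fderiv ℝ (fderiv ℝ H) q.1 (e' y • e)) e = 0 := by
          rw [_root_.add_apply, _root_.smul_apply, hdd, hζe]
          simp
        simp only [h1, zero_smul, add_zero, add_sub_cancel_right]
        rw [hζ, J.apply_symm_apply, map_smul, he q.1 hqW]
        simp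
      · have hker : ∀ c : E × (E →L[ℝ] ℝ), fderiv ℝ (conormalDefining H e J) q c = 0 →
            fderiv ℝ H q.1 c.1 = 0 ∧
              c.2 = q.2 e • fderiv ℝ (fderiv ℝ H) q.1 c.1 + c.2 e • fderiv ℝ H q.1 := by
          intro c hc
          rw [fderiv_conormalDefining_apply hW hH J hqW] at hc
          have h1 := congrArg e' hc
          rw [map_add, hJ, map_smul, he', map_zero] at h1
          simp [he q.1 hqW, hdd] at h1
          rw [h1, zero_smul, zero_add, map_eq_zero_iff J J.injective, sub_eq_zero] at hc
          exact ⟨h1, hc⟩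
        obtain ⟨ha1, ha2⟩ := hker a ha
        obtain ⟨hb1, hb2⟩ := hker b hb
        have hsym : IsSymmSndFDerivAt ℝ H q.1 :=
          (hH.contDiffAt (hW.mem_nhds hqW)).isSymmSndFDerivAt
            (by rw [minSmoothness_of_isRCLikeNormedField]
                exact WithTop.coe_le_coe.2 (le_top : (2 : ℕ∞) ≤ ⊤))
        rw [canonicalSymplectic, ha2, hb2]
        simp [ha1, hb1, hsym.eq a.1 b.1]

end ConormalBundle

/-! ### Isometric change of the phase variable and sign convention. -/

section PhaseVariable

variable {E : Type*} [NormedAddCommGroup E] [NormedSpace ℝ E]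

/-- Precomposition with an isometry preserves the norms of multilinear maps, so the same constants
serve. This carries a symbol on the real line over to `EuclideanSpace ℝ (Fin 1)`. -/
theorem IsSymbol.comp_linearIsometryEquiv {Θ Θ' : Type*} [NormedAddCommGroup Θ] [NormedSpace ℝ Θ]
    [NormedAddCommGroup Θ'] [NormedSpace ℝ Θ'] {m : ℝ} {W : Set E} {a : E × Θ → ℂ}
    (ha : IsSymbol m W a) (ℓ : Θ' ≃ₗᵢ[ℝ] Θ) : IsSymbol m W fun p : E × Θ' => a (p.1, ℓ p.2) := by
  refine ⟨ha.1.comp (contDiff_fst.prodMk (ℓ.contDiff.comp contDiff_snd)).contDiffOn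
    fun p hp => ⟨hp.1, mem_univ _⟩, fun K hK hKW j k => ?_⟩
  obtain ⟨C, hC⟩ := ha.2 K hK hKW j k
  refine ⟨C, fun x hx θ => ?_⟩
  let Φ : ContinuousMultilinearMap ℝ (fun _ : Fin k => Θ) ℂ ≃ₗᵢ[ℝ]
      ContinuousMultilinearMap ℝ (fun _ : Fin k => Θ') ℂ :=
    { (ContinuousLinearEquiv.continuousMultilinearMapCongrLeft ℂ
        (fun _ : Fin k => ℓ.toContinuousLinearEquiv)).toLinearEquiv with
      norm_map' := fun g =>
        ContinuousMultilinearMap.norm_compContinuous_linearIsometryEquiv g fun _ => ℓ }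
  have h : (fun x' => iteratedFDeriv ℝ k (fun θ' => a (x', ℓ θ')) θ)
      = Φ ∘ fun x' => iteratedFDeriv ℝ k (fun θ' => a (x', θ')) (ℓ θ) := by
    funext x'
    have := ℓ.toContinuousLinearEquiv.iteratedFDerivWithin_comp_right (fun θ' => a (x', θ'))
      uniqueDiffOn_univ (x := θ) (mem_univ _) k
    simp only [preimage_univ, iteratedFDerivWithin_univ] at this
    exact this
  change ‖iteratedFDeriv ℝ j (fun x' => iteratedFDeriv ℝ k (fun θ' => a (x', ℓ θ')) θ) x‖ ≤ _
  rw [h, LinearIsometryEquiv.norm_iteratedFDeriv_comp_left, ← ℓ.norm_map θ]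
  exact hC x hx (ℓ θ)

theorem IsCutoff.comp_linearIsometryEquiv_symm {Θ : Type*} [NormedAddCommGroup Θ]
    [NormedSpace ℝ Θ] {χ : Θ → ℝ} (hχ : IsCutoff χ) (ℓ : Θ ≃ₗᵢ[ℝ] ℝ) :
    IsCutoff fun w => χ (ℓ.symm w) where
  smooth := hχ.smooth.comp ℓ.symm.contDiff
  compact := hχ.compact.comp_homeomorph ℓ.symm.toHomeomorph
  eq_one := by
    have h : Tendsto ℓ.symm (𝓝 0) (𝓝 0) := by simpa using ℓ.symm.continuous.tendsto 0
    exact h.eventually hχ.eq_one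

variable [MeasureSpace E] [BorelSpace E] [(volume : Measure E).IsAddHaarMeasure]
  [FiniteDimensional ℝ E]

/-- Oscillatory integrals are normalized with `exp (i φ)`, whereas the pairing has `exp (-i w H)`;
the negation in the phase accounts for the sign. -/
theorem isOscillatoryIntegral_linearPhase {Θ : Type*} [NormedAddCommGroup Θ] [NormedSpace ℝ Θ]
    [MeasureSpace Θ] [BorelSpace Θ] {m : ℝ} {W : Set E} (hW : IsOpen W) {H : E → ℝ}
    (hH : ContDiffOn ℝ ∞ H W) {e : E} (he : ∀ x ∈ W, fderiv ℝ H x e = 1)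
    {A : E × ℝ → ℂ} (hA : IsSymbol m W A) (ℓ : Θ ≃ₗᵢ[ℝ] ℝ) (hℓ : MeasurePreserving ℓ)
    {f : E → ℝ} (hf : ContDiff ℝ ∞ f) (hc : HasCompactSupport f) (hfW : tsupport f ⊆ W) :
    IsOscillatoryIntegral (linearPhase H (ℓ.toContinuousLinearEquiv.trans (.neg ℝ)))
      (fun p : E × Θ => A (p.1, ℓ p.2)) f (oscPairing H A fun x => (f x : ℂ)) := by
  intro χ hχ
  have hfC : ContDiff ℝ ∞ fun x => (f x : ℂ) := Complex.ofRealCLM.contDiff.comp hf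
  have hcC : HasCompactSupport fun x => (f x : ℂ) :=
    hc.comp_left (g := Complex.ofReal) Complex.ofReal_zero
  have hfWC : tsupport (fun x => (f x : ℂ)) ⊆ W :=
    (tsupport_comp_subset (g := Complex.ofReal) Complex.ofReal_zero f).trans hfW
  have hχ' := hχ.comp_linearIsometryEquiv_symm ℓ
  refine (hχ'.tendsto_integral (integrable_fibreIntegral hW hH he hA hfC hcC hfWC)).congr' ?_
  filter_upwards [self_mem_nhdsWithin] with ε hε
  rw [← integral_integral_cutoff_mul hW hH hA hfC.continuous hcC hfWC
    (hχ'.continuous_scaled ε) (hχ'.hasCompactSupport_scaled hε)]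
  congr 1
  funext x
  rw [← hℓ.integral_comp ℓ.toHomeomorph.measurableEmbedding]
  congr 1
  funext θ
  have h1 : ℓ.symm (ε * ℓ θ) = ε • θ := by
    rw [← smul_eq_mul, map_smul, ℓ.symm_apply_apply]
  have h2 : Complex.exp (Complex.I
      * (linearPhase H (ℓ.toContinuousLinearEquiv.trans (.neg ℝ)) (x, θ) : ℂ))
        = oscFactor H (ℓ θ) x := by
    rw [oscFactor, linearPhase]
    congr 1
    simp
    ring
  rw [h1, h2]
  ring

end PhaseVariable

/-- Reconciles two orders of integration: the operator integrates over `(ω, q)` for fixed `y`, the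
kernel over `ω` for fixed `(y, q)`. -/
theorem integral_integral_prod_swap {Y Q : Type*} [MeasureSpace Y] [MeasureSpace Q]
    [SigmaFinite (volume : Measure Y)] [SigmaFinite (volume : Measure Q)]
    {Φ : (Y × Q) × ℝ → ℂ} (hΦ : Integrable Φ) :
    ∫ y, ∫ p : ℝ × Q, Φ ((y, p.2), p.1) = ∫ x : Y × Q, ∫ w, Φ (x, w) := by
  let T : (Y × Q) × ℝ ≃ᵐ Y × (ℝ × Q) :=
    MeasurableEquiv.prodAssoc.trans (MeasurableEquiv.prodCongr (.refl Y) .prodComm)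
  have hT : MeasurePreserving T :=
    ((MeasurePreserving.id volume).prod Measure.measurePreserving_swap).comp
      volume_preserving_prodAssoc
  have h1 : Integrable fun z : Y × (ℝ × Q) => Φ ((z.1, z.2.2), z.2.1) :=
    (hT.integrable_comp_emb T.measurableEmbedding).1 hΦ
  calc ∫ y, ∫ p : ℝ × Q, Φ ((y, p.2), p.1)
      = ∫ z : Y × (ℝ × Q), Φ ((z.1, z.2.2), z.2.1) := (integral_prod _ h1).symm
    _ = ∫ z, Φ z := (hT.integral_comp T.measurableEmbedding _).symm
    _ = _ := integral_prod _ hΦ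

/-! ### Derivative bounds for tensor products of test functions. -/

section Tensor

/-- The complex-valued function `(y, x) ↦ g y * v x`. -/
def complexTensor {X₁ X₂ : Type*} (g : X₁ → ℝ) (v : X₂ → ℂ) (p : X₁ × X₂) : ℂ := g p.1 * v p.2

theorem tsupport_complexTensor_subset {X₁ X₂ : Type*} [TopologicalSpace X₁]
    [TopologicalSpace X₂] (g : X₁ → ℝ) (v : X₂ → ℂ) :
    tsupport (complexTensor g v) ⊆ tsupport g ×ˢ tsupport v := by
  refine closure_minimal (fun p hp => ?_) ((isClosed_tsupport _).prod (isClosed_tsupport _))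
  have hp' : (g p.1 : ℂ) * v p.2 ≠ 0 := hp
  exact ⟨subset_tsupport _ (Complex.ofReal_ne_zero.1 (left_ne_zero_of_mul hp')),
    subset_tsupport _ (right_ne_zero_of_mul hp')⟩

variable {E₁ E₂ : Type*} [NormedAddCommGroup E₁] [NormedSpace ℝ E₁]
  [NormedAddCommGroup E₂] [NormedSpace ℝ E₂]

theorem hasCompactSupport_complexTensor {X₁ X₂ : Type*} [TopologicalSpace X₁]
    [TopologicalSpace X₂] {g : X₁ → ℝ} {v : X₂ → ℂ} (hg : HasCompactSupport g)
    (hv : HasCompactSupport v) : HasCompactSupport (complexTensor g v) :=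
  (hg.isCompact.prod hv.isCompact).of_isClosed_subset (isClosed_tsupport _)
    (tsupport_complexTensor_subset g v)

theorem norm_iteratedFDeriv_comp_fst_le {F : Type*} [NormedAddCommGroup F] [NormedSpace ℝ F]
    {g : E₁ → F} (hg : ContDiff ℝ ∞ g) (i : ℕ) (p : E₁ × E₂) :
    ‖iteratedFDeriv ℝ i (fun p : E₁ × E₂ => g p.1) p‖ ≤ ‖iteratedFDeriv ℝ i g p.1‖ := by
  have h := (ContinuousLinearMap.fst ℝ E₁ E₂).iteratedFDeriv_comp_right hg p (i := i)
    (by exact_mod_cast le_top)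
  change ‖iteratedFDeriv ℝ i (g ∘ ContinuousLinearMap.fst ℝ E₁ E₂) p‖ ≤ _
  rw [h]
  refine (ContinuousMultilinearMap.norm_compContinuousLinearMap_le _ _).trans ?_
  refine mul_le_of_le_one_right (norm_nonneg _) (Finset.prod_le_one (fun _ _ => norm_nonneg _)
    fun _ _ => ContinuousLinearMap.norm_fst_le ℝ E₁ E₂)

theorem norm_iteratedFDeriv_comp_snd_le {F : Type*} [NormedAddCommGroup F] [NormedSpace ℝ F]
    {g : E₂ → F} (hg : ContDiff ℝ ∞ g) (i : ℕ) (p : E₁ × E₂) :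
    ‖iteratedFDeriv ℝ i (fun p : E₁ × E₂ => g p.2) p‖ ≤ ‖iteratedFDeriv ℝ i g p.2‖ := by
  have h := (ContinuousLinearMap.snd ℝ E₁ E₂).iteratedFDeriv_comp_right hg p (i := i)
    (by exact_mod_cast le_top)
  change ‖iteratedFDeriv ℝ i (g ∘ ContinuousLinearMap.snd ℝ E₁ E₂) p‖ ≤ _
  rw [h]
  refine (ContinuousMultilinearMap.norm_compContinuousLinearMap_le _ _).trans ?_
  refine mul_le_of_le_one_right (norm_nonneg _) (Finset.prod_le_one (fun _ _ => norm_nonneg _)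
    fun _ _ => ContinuousLinearMap.norm_snd_le ℝ E₁ E₂)

theorem contDiff_complexTensor {g : E₁ → ℝ} {v : E₂ → ℂ} (hg : ContDiff ℝ ∞ g)
    (hv : ContDiff ℝ ∞ v) : ContDiff ℝ ∞ (complexTensor g v) :=
  (Complex.ofRealCLM.contDiff.comp (hg.comp contDiff_fst)).mul (hv.comp contDiff_snd)

theorem norm_iteratedFDeriv_ofReal_comp (f : E₁ → ℝ) (i : ℕ) {x : E₁} (hf : ContDiff ℝ ∞ f) :
    ‖iteratedFDeriv ℝ i (fun x => (f x : ℂ)) x‖ = ‖iteratedFDeriv ℝ i f x‖ :=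
  Complex.ofRealLI.norm_iteratedFDeriv_comp_left (f := f) hf.contDiffAt (by exact_mod_cast le_top)

theorem norm_iteratedFDeriv_complexTensor_le {g : E₁ → ℝ} {v : E₂ → ℂ} (hg : ContDiff ℝ ∞ g)
    (hv : ContDiff ℝ ∞ v) {n : ℕ} {B B' : ℝ} (hB : ∀ i ≤ n, ∀ y, ‖iteratedFDeriv ℝ i g y‖ ≤ B)
    (hB' : ∀ i ≤ n, ∀ x, ‖iteratedFDeriv ℝ i v x‖ ≤ B') {i : ℕ} (hi : i ≤ n) (p : E₁ × E₂) :
    ‖iteratedFDeriv ℝ i (complexTensor g v) p‖ ≤ 2 ^ n * B' * B := by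
  have hB0 : 0 ≤ B := (norm_nonneg _).trans (hB 0 (Nat.zero_le _) p.1)
  have hB0' : 0 ≤ B' := (norm_nonneg _).trans (hB' 0 (Nat.zero_le _) p.2)
  have hgC : ContDiff ℝ ∞ fun y => (g y : ℂ) := Complex.ofRealCLM.contDiff.comp hg
  have h := norm_iteratedFDeriv_mul_le (𝕜 := ℝ) (f := fun p : E₁ × E₂ => (g p.1 : ℂ))
    (g := fun p : E₁ × E₂ => v p.2) (hgC.comp contDiff_fst) (hv.comp contDiff_snd) p
    (n := i) (by exact_mod_cast le_top)
  refine h.trans ?_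
  calc _ ≤ ∑ k ∈ Finset.range (i + 1), (i.choose k : ℝ) * B * B' := by
        refine Finset.sum_le_sum fun k hk => ?_
        have hk' : k ≤ i := Nat.lt_succ_iff.1 (Finset.mem_range.1 hk)
        gcongr
        · refine (norm_iteratedFDeriv_comp_fst_le hgC k p).trans ?_
          rw [norm_iteratedFDeriv_ofReal_comp g k hg]
          exact hB k (hk'.trans hi) _
        · exact (norm_iteratedFDeriv_comp_snd_le hv (i - k) p).trans
            (hB' _ ((Nat.sub_le _ _).trans hi) _)
    _ = 2 ^ i * B * B' := by
        rw [← Finset.sum_mul, ← Finset.sum_mul, ← Nat.cast_sum, Nat.sum_range_choose]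
        push_cast
        rfl
    _ ≤ 2 ^ n * B * B' := by
        have h2 : (2 : ℝ) ^ i ≤ 2 ^ n := pow_le_pow_right₀ (by norm_num) hi
        gcongr
    _ = _ := by ring

end Tensor

/-! ### The radar geometry and the forward operator. -/

theorem isAddHaarMeasure_volume_plane : (volume : Measure (ℝ × ℝ)).IsAddHaarMeasure :=
  Measure.prod.instIsAddHaarMeasure _ _

instance isAddHaarMeasure_volume_plane_prod :
    (volume : Measure ((ℝ × ℝ) × (ℝ × ℝ))).IsAddHaarMeasure :=
  have := isAddHaarMeasure_volume_plane
  Measure.prod.instIsAddHaarMeasure _ _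

namespace SAR

variable (D : SAR)

/-- The difference `t - (2 / c₀) |R (u, v, s)|` between the time and the travel time. -/
def delay (p : (ℝ × ℝ) × (ℝ × ℝ)) : ℝ := p.1.2 - 2 / D.c₀ * ‖D.R p.2 p.1.1‖

/-- The direction `∂/∂t`. -/
def timeDirection : (ℝ × ℝ) × (ℝ × ℝ) := ((0, 1), (0, 0))

@[simp]
theorem covector_apply (σ τ ξ η : ℝ) (v : (ℝ × ℝ) × (ℝ × ℝ)) :
    covector σ τ ξ η v = σ * v.1.1 + τ * v.1.2 + ξ * v.2.1 + η * v.2.2 := by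
  simp [covector]

variable {D}

theorem mem_U_of_mem_visible {q : ℝ × ℝ} (hq : q ∈ D.visible) : q ∈ D.U := hq.1

theorem mem_J_of_mem_dataDomain {y : ℝ × ℝ} (hy : y ∈ D.dataDomain) : y.1 ∈ D.J :=
  D.window_subset hy.1

theorem R_ne_zero (hdist : 0 < setEDist D.surface D.path) {q : ℝ × ℝ} (hq : q ∈ D.U) {s : ℝ}
    (hs : s ∈ D.J) : D.R q s ≠ 0 := by
  intro h
  have h1 : D.ψ q = D.γ s := sub_eq_zero.1 h
  have h2 : setEDist D.surface D.path ≤ Metric.infEDist (D.ψ q) D.path :=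
    iInf₂_le (D.ψ q) (mem_image_of_mem _ hq)
  rw [Metric.infEDist_zero_of_mem (h1 ▸ mem_image_of_mem _ hs)] at h2
  exact absurd hdist (not_lt.2 h2)

theorem contDiffOn_R : ContDiffOn ℝ ∞ (fun p : (ℝ × ℝ) × (ℝ × ℝ) => D.R p.2 p.1.1) D.base :=
  (D.ψ_smooth.comp contDiff_snd.contDiffOn fun _ hp => mem_U_of_mem_visible hp.2).sub
    (D.γ_smooth.comp (contDiff_fst.comp contDiff_fst).contDiffOn
      fun _ hp => mem_J_of_mem_dataDomain hp.1)

theorem contDiffOn_delay (hdist : 0 < setEDist D.surface D.path) :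
    ContDiffOn ℝ ∞ D.delay D.base :=
  (contDiff_snd.comp contDiff_fst).contDiffOn.sub (contDiffOn_const.mul
    (contDiffOn_R.norm ℝ fun _ hp =>
      R_ne_zero hdist (mem_U_of_mem_visible hp.2) (mem_J_of_mem_dataDomain hp.1)))

/-- The projection is self-adjoint and fixes the tangent vectors of the surface, so it does not
affect these inner products. -/
theorem inner_projRhat (q : ℝ × ℝ) (s : ℝ) (a : ℝ × ℝ) :
    inner ℝ (D.projRhat q s) (fderiv ℝ D.ψ q a) = inner ℝ (D.Rhat q s) (fderiv ℝ D.ψ q a) := by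
  have h : fderiv ℝ D.ψ q a ∈ D.tangentPlane q := ⟨a, rfl⟩
  rw [projRhat, Submodule.inner_starProjection_left_eq_right,
    Submodule.starProjection_eq_self_iff.2 h]

theorem fderiv_delay (hdist : 0 < setEDist D.surface D.path) {p : (ℝ × ℝ) × (ℝ × ℝ)}
    (hp : p ∈ (D.base : Set ((ℝ × ℝ) × (ℝ × ℝ)))) :
    fderiv ℝ D.delay p =
      covector (2 / D.c₀ * inner ℝ (D.Rhat p.2 p.1.1) (deriv D.γ p.1.1)) 1
        (-(2 / D.c₀) * (D.projCovector p.2 p.1.1).1)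
        (-(2 / D.c₀) * (D.projCovector p.2 p.1.1).2) := by
  have hU := mem_U_of_mem_visible hp.2
  have hJ := mem_J_of_mem_dataDomain hp.1
  have hR := R_ne_zero hdist hU hJ
  have hψ : HasFDerivAt D.ψ (fderiv ℝ D.ψ p.2) p.2 :=
    ((D.ψ_smooth.contDiffAt (D.U_open.mem_nhds hU)).differentiableAt (by simp)).hasFDerivAt
  have hγ : HasFDerivAt D.γ (fderiv ℝ D.γ p.1.1) p.1.1 :=
    ((D.γ_smooth.contDiffAt (D.J_open.mem_nhds hJ)).differentiableAt (by simp)).hasFDerivAt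
  have h1 := (hψ.comp p hasFDerivAt_snd).sub (hγ.comp p (hasFDerivAt_fst.comp p hasFDerivAt_fst))
  -- The norm is differentiated as the square root of its square, which is legitimate because `R` is
  -- nonzero.
  have h2 := h1.norm_sq.sqrt (pow_ne_zero 2 (norm_ne_zero_iff.2 hR))
  have h3 := ((hasFDerivAt_snd (𝕜 := ℝ) (p := p.1)).comp p hasFDerivAt_fst).sub
    (h2.const_mul (2 / D.c₀))
  have h4 : HasFDerivAt D.delay _ p := h3.congr_of_eventuallyEq (Eventually.of_forall fun q => by
    simp [delay, R])
  rw [h4.fderiv]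
  refine ContinuousLinearMap.ext fun v => ?_
  have hv : fderiv ℝ D.ψ p.2 v.2
      = v.2.1 • fderiv ℝ D.ψ p.2 (1, 0) + v.2.2 • fderiv ℝ D.ψ p.2 (0, 1) := by
    rw [← map_smul, ← map_smul, ← map_add]
    simp
  have hn : ‖D.R p.2 p.1.1‖ ≠ 0 := norm_ne_zero_iff.2 hR
  have hin : ∀ a, inner ℝ (D.Rhat p.2 p.1.1) a = inner ℝ (D.R p.2 p.1.1) a / ‖D.R p.2 p.1.1‖ := by
    intro a
    rw [Rhat, real_inner_smul_left]
    field_simp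
  have hsq : √(‖D.ψ p.2 - D.γ p.1.1‖ ^ 2) = ‖D.R p.2 p.1.1‖ := Real.sqrt_sq (norm_nonneg _)
  simp only [covector_apply, projCovector, inner_projRhat, hin]
  simp [hv, hsq]
  have hRi : ∀ a, inner ℝ (D.R p.2 p.1.1) a = inner ℝ (D.ψ p.2) a - inner ℝ (D.γ p.1.1) a :=
    fun a => inner_sub_left _ _ _
  have hc := D.c₀_pos.ne'
  simp only [hRi, inner_add_right, real_inner_smul_right]
  field_simp
  ring

theorem fderiv_delay_timeDirection (hdist : 0 < setEDist D.surface D.path) :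
    ∀ p ∈ (D.base : Set ((ℝ × ℝ) × (ℝ × ℝ))), fderiv ℝ D.delay p timeDirection = 1 := by
  intro p hp
  rw [fderiv_delay hdist hp, covector_apply]
  simp [timeDirection]

theorem smul_covector (r σ τ ξ η : ℝ) :
    r • covector σ τ ξ η = covector (r * σ) (r * τ) (r * ξ) (r * η) := by
  refine ContinuousLinearMap.ext fun v => ?_
  rw [_root_.smul_apply, covector_apply, covector_apply, smul_eq_mul]
  ring

/-- The `dt` component of `r dH` is `r`, so the multiplier is `τ`, and the formulas for `σ`, `ξ`,
`η` are `τ` times the components of `dH`. In particular the covector is nonzero exactly when `τ` is.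
-/
theorem Λ_eq_conormalBundle (hdist : 0 < setEDist D.surface D.path) :
    D.Λ = conormalBundle D.base D.delay := by
  ext p
  constructor
  · rintro ⟨s, t, σ, τ, u, v, ξ, η, rfl, hy, hx, hne, ht, hσ, hξη⟩
    obtain ⟨hξ, hη⟩ := Prod.ext_iff.1 hξη
    simp only [Prod.smul_fst, Prod.smul_snd, smul_eq_mul] at hξ hη
    refine ⟨⟨hy, hx⟩, sub_eq_zero.2 ht, τ, ?_, ?_⟩
    · rintro rfl
      simp only [mul_zero, zero_div, neg_zero, zero_mul] at hσ hξ hη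
      exact hne (by rw [hσ, hξ, hη]; rfl)
    · rw [fderiv_delay hdist (p := ((s, t), (u, v))) ⟨hy, hx⟩, smul_covector, hσ, hξ, hη]
      change covector _ _ _ _ = covector _ _ _ _
      congr 1 <;> ring
  · obtain ⟨⟨⟨s, t⟩, ⟨u, v⟩⟩, ζ⟩ := p
    rintro ⟨⟨hy, hx⟩, h0, r, hr, hζ⟩
    refine ⟨s, t, 2 * r / D.c₀ * inner ℝ (D.Rhat (u, v) s) (deriv D.γ s), r, u, v,
      -(2 * r / D.c₀) * (D.projCovector (u, v) s).1, -(2 * r / D.c₀) * (D.projCovector (u, v) s).2,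
      ?_, hy, hx, fun h => hr (congrArg (fun z : ℝ × ℝ × ℝ × ℝ => z.2.1) h), sub_eq_zero.1 h0, rfl,
      rfl⟩
    refine Prod.ext rfl (hζ.trans ?_)
    rw [fderiv_delay hdist (p := ((s, t), (u, v))) ⟨hy, hx⟩, smul_covector]
    change covector _ _ _ _ = covector _ _ _ _
    congr 1 <;> ring

/-- The coordinates of a covector. -/
def covectorEquiv : ((ℝ × ℝ) × (ℝ × ℝ) →L[ℝ] ℝ) ≃L[ℝ] (ℝ × ℝ) × (ℝ × ℝ) :=
  LinearEquiv.toContinuousLinearEquiv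
    { toFun := fun ζ => ((ζ ((1, 0), (0, 0)), ζ ((0, 1), (0, 0))),
        (ζ ((0, 0), (1, 0)), ζ ((0, 0), (0, 1))))
      map_add' := fun _ _ => rfl
      map_smul' := fun _ _ => rfl
      invFun := fun p => covector p.1.1 p.1.2 p.2.1 p.2.2
      left_inv := fun ζ => by
        refine ContinuousLinearMap.ext fun v => ?_
        have hv : v = v.1.1 • ((1, 0), (0, 0)) + v.1.2 • ((0, 1), (0, 0))
            + v.2.1 • ((0, 0), (1, 0)) + v.2.2 • ((0, 0), (0, 1)) := by
          ext <;> simp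
        conv_rhs => rw [hv]
        simp only [map_add, map_smul, covector_apply, smul_eq_mul]
        ring
      right_inv := fun p => by simp }

theorem isConicLagrangian_Λ (hdist : 0 < setEDist D.surface D.path) :
    IsConicLagrangian (D.base : Set ((ℝ × ℝ) × (ℝ × ℝ))) D.Λ := by
  rw [Λ_eq_conormalBundle hdist]
  exact isConicLagrangian_conormalBundle D.base.isOpen (contDiffOn_delay hdist)
    (fderiv_delay_timeDirection hdist) covectorEquiv
    -- This functional reads the `t` coordinate, which `covectorEquiv` fills with the value of the
    -- covector at `∂/∂t`.
    (e' := (ContinuousLinearMap.snd ℝ ℝ ℝ).comp (ContinuousLinearMap.fst ℝ (ℝ × ℝ) (ℝ × ℝ)))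
    (by simp [timeDirection]) fun _ => rfl

variable {A : ((ℝ × ℝ) × (ℝ × ℝ)) × ℝ → ℂ} {m : ℝ}

/-- The Schwartz kernel of the forward operator with amplitude `A`. -/
def forwardKernel (hdist : 0 < setEDist D.surface D.path)
    (hA : IsSymbol m (D.base : Set ((ℝ × ℝ) × (ℝ × ℝ))) A) :
    𝓓'(opensProd D.dataDomain D.visible, ℂ) :=
  distributionOfBound
    { toFun := fun f => oscPairing D.delay A fun x => (f x : ℂ)
      map_add' := fun f g => by
        have h := oscPairing_add D.base.isOpen (contDiffOn_delay hdist)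
          (fderiv_delay_timeDirection hdist) hA
          (Complex.ofRealCLM.contDiff.comp f.contDiff)
          (f.hasCompactSupport.comp_left (g := Complex.ofReal) Complex.ofReal_zero)
          ((tsupport_comp_subset (g := Complex.ofReal) Complex.ofReal_zero f).trans
            f.tsupport_subset)
          (Complex.ofRealCLM.contDiff.comp g.contDiff)
          (g.hasCompactSupport.comp_left (g := Complex.ofReal) Complex.ofReal_zero)
          ((tsupport_comp_subset (g := Complex.ofReal) Complex.ofReal_zero g).trans
            g.tsupport_subset)
        refine Eq.trans ?_ h
        congr 1
        funext x
        simp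
      map_smul' := fun c f => by
        rw [RingHom.id_apply, Complex.real_smul, ← oscPairing_const_mul]
        congr 1
        funext x
        simp }
    fun K hK hKW => by
      obtain ⟨n, C, hC0, hC⟩ := exists_norm_oscPairing_le D.base.isOpen (contDiffOn_delay hdist)
        (fderiv_delay_timeDirection hdist) hA hK hKW
      refine ⟨n, C, hC0, fun f B hf hB => ?_⟩
      refine (hC (fun x => (f x : ℂ)) B (Complex.ofRealCLM.contDiff.comp f.contDiff)
        ((tsupport_comp_subset (g := Complex.ofReal) Complex.ofReal_zero f).trans hf)
        fun i hi x => ?_).2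
      rw [norm_iteratedFDeriv_ofReal_comp _ i f.contDiff]
      exact hB i hi x

theorem tsupport_tensor_subset_base (g : 𝓓(D.dataDomain, ℝ)) (V : 𝓓(D.visible, ℂ)) :
    tsupport (complexTensor g V) ⊆ (D.base : Set ((ℝ × ℝ) × (ℝ × ℝ))) :=
  (tsupport_complexTensor_subset g V).trans (prod_mono g.tsupport_subset V.tsupport_subset)

theorem oscPairing_tensor_add (hdist : 0 < setEDist D.surface D.path)
    (hA : IsSymbol m (D.base : Set ((ℝ × ℝ) × (ℝ × ℝ))) A) (g g' : 𝓓(D.dataDomain, ℝ))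
    (V V' : 𝓓(D.visible, ℂ)) :
    oscPairing D.delay A (fun p => complexTensor g V p + complexTensor g' V' p)
      = oscPairing D.delay A (complexTensor g V) + oscPairing D.delay A (complexTensor g' V') :=
  oscPairing_add D.base.isOpen (contDiffOn_delay hdist) (fderiv_delay_timeDirection hdist) hA
    (contDiff_complexTensor g.contDiff V.contDiff)
    (hasCompactSupport_complexTensor g.hasCompactSupport V.hasCompactSupport)
    (tsupport_tensor_subset_base g V) (contDiff_complexTensor g'.contDiff V'.contDiff)
    (hasCompactSupport_complexTensor g'.hasCompactSupport V'.hasCompactSupport)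
    (tsupport_tensor_subset_base g' V')

/-- The distribution `F V` on the data domain. -/
def forwardDistribution (hdist : 0 < setEDist D.surface D.path)
    (hA : IsSymbol m (D.base : Set ((ℝ × ℝ) × (ℝ × ℝ))) A) (V : 𝓓(D.visible, ℂ)) :
    𝓓'(D.dataDomain, ℂ) :=
  distributionOfBound
    { toFun := fun g => oscPairing D.delay A (complexTensor g V)
      map_add' := fun g g' => by
        rw [← oscPairing_tensor_add hdist hA]
        congr 1
        funext p
        simp [complexTensor, add_mul]
      map_smul' := fun c g => by
        rw [RingHom.id_apply, Complex.real_smul, ← oscPairing_const_mul]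
        congr 1
        funext p
        simp [complexTensor, mul_assoc] }
    fun K hK hKW => by
      obtain ⟨n, C, hC0, hC⟩ := exists_norm_oscPairing_le D.base.isOpen (contDiffOn_delay hdist)
        (fderiv_delay_timeDirection hdist) hA (hK.prod V.hasCompactSupport.isCompact)
        (prod_mono hKW V.tsupport_subset)
      obtain ⟨B', hB0', hB'⟩ := exists_norm_iteratedFDeriv_le V.contDiff V.hasCompactSupport n
      -- `V` is fixed, so bounds on its derivatives enter the constant and only those of `g` remain
      -- in `B`.
      refine ⟨n, C * (2 ^ n * B'), by positivity, fun g B hg hB => ?_⟩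
      rw [mul_assoc]
      exact (hC (complexTensor g V) (2 ^ n * B' * B) (contDiff_complexTensor g.contDiff V.contDiff)
        ((tsupport_complexTensor_subset g V).trans (prod_mono hg subset_rfl))
        fun i hi p => norm_iteratedFDeriv_complexTensor_le g.contDiff V.contDiff hB hB' hi p).2

/-- The forward operator with amplitude `A`. -/
def forwardOperator (hdist : 0 < setEDist D.surface D.path)
    (hA : IsSymbol m (D.base : Set ((ℝ × ℝ) × (ℝ × ℝ))) A) :
    𝓓(D.visible, ℂ) →ₗ[ℂ] 𝓓'(D.dataDomain, ℂ) where
  toFun V := forwardDistribution hdist hA V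
  map_add' V V' := by
    ext g
    refine Eq.trans ?_ (oscPairing_tensor_add hdist hA g g V V')
    change oscPairing D.delay A _ = _
    congr 1
    funext p
    simp [complexTensor, mul_add]
  map_smul' c V := by
    ext g
    refine Eq.trans ?_ (oscPairing_const_mul D.delay A (complexTensor g V) c)
    change oscPairing D.delay A _ = _
    congr 1
    funext p
    simp [complexTensor, mul_left_comm]

/-- The pairing is complex linear in its test function, so it may be evaluated on the real and
imaginary parts of `V` separately. -/
theorem isSchwartzKernel_forwardKernel (hdist : 0 < setEDist D.surface D.path)
    (hA : IsSymbol m (D.base : Set ((ℝ × ℝ) × (ℝ × ℝ))) A) :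
    IsSchwartzKernel (forwardOperator hdist hA) (forwardKernel hdist hA) := by
  intro V g
  let ofRealTest (v : 𝓓(D.visible, ℝ)) : 𝓓(D.visible, ℂ) :=
    TestFunction.postcompCLM (𝕜 := ℝ) Complex.ofRealCLM v
  have h := oscPairing_tensor_add hdist hA g g (ofRealTest (testRe V))
    (Complex.I • ofRealTest (testIm V))
  have h1 : complexTensor g (Complex.I • ofRealTest (testIm V))
      = fun p => Complex.I * complexTensor g (ofRealTest (testIm V)) p := by
    funext p
    simp [complexTensor, mul_left_comm]
  rw [h1, oscPairing_const_mul] at h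
  have h2 : ∀ v : 𝓓(D.visible, ℝ), forwardKernel hdist hA (testTensor g v)
      = oscPairing D.delay A (complexTensor g (ofRealTest v)) := by
    intro v
    change oscPairing D.delay A _ = _
    congr 1
    funext p
    exact Complex.ofReal_mul _ _
  rw [h2, h2, ← h]
  change oscPairing D.delay A _ = _
  congr 1
  funext p
  change (g p.1 : ℂ) * V p.2 = (g p.1 : ℂ) * ((V p.2).re : ℂ)
    + Complex.I * ((g p.1 : ℂ) * ((V p.2).im : ℂ))
  conv_lhs => rw [← Complex.re_add_im (V p.2)]
  ring

/-- For each `ε > 0` the regularized integral equals the cutoff integral of `fibreIntegral` by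
Fubini. Restriction to the two domains changes nothing, since `g` and `V` vanish outside them. -/
theorem isForwardOperator_forwardOperator (hdist : 0 < setEDist D.surface D.path)
    (hA : IsSymbol m (D.base : Set ((ℝ × ℝ) × (ℝ × ℝ))) A) :
    D.IsForwardOperator A (forwardOperator hdist hA) := by
  intro χ hχ V g
  have hf := contDiff_complexTensor g.contDiff V.contDiff
  have hc := hasCompactSupport_complexTensor g.hasCompactSupport V.hasCompactSupport
  have hfW := tsupport_tensor_subset_base g V
  have hH := contDiffOn_delay hdist
  refine (hχ.tendsto_integral (integrable_fibreIntegral D.base.isOpen hH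
    (fderiv_delay_timeDirection hdist) hA hf hc hfW)).congr' ?_
  filter_upwards [self_mem_nhdsWithin] with ε hε
  have hint := integrable_cutoff_mul D.base.isOpen hH hA hf.continuous hc hfW
    (hχ.continuous_scaled ε) (hχ.hasCompactSupport_scaled hε)
  rw [← integral_integral_cutoff_mul D.base.isOpen hH hA hf.continuous hc hfW
    (hχ.continuous_scaled ε) (hχ.hasCompactSupport_scaled hε),
    ← integral_integral_prod_swap hint]
  rw [← setIntegral_eq_integral_of_forall_compl_eq_zero
    (s := (D.dataDomain : Set (ℝ × ℝ)))]
  · refine integral_congr_ae (Eventually.of_forall fun y => ?_)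
    simp only [regularizedForward]
    rw [← integral_mul_const, ← setIntegral_eq_integral_of_forall_compl_eq_zero
      (s := univ ×ˢ (D.visible : Set (ℝ × ℝ)))]
    · refine integral_congr_ae (Eventually.of_forall fun p => ?_)
      have he : oscFactor D.delay p.1 (y, p.2) = Complex.exp (-Complex.I * (p.1 : ℂ)
          * ((y.2 - 2 / D.c₀ * ‖D.R p.2 y.1‖ : ℝ) : ℂ)) := by
        rw [oscFactor]
        congr 1
        simp only [delay]
        ring
      simp only [← he, complexTensor]
      ring
    · intro p hp
      have hp' : p.2 ∉ tsupport V := fun h => hp ⟨mem_univ _, V.tsupport_subset h⟩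
      simp [complexTensor, image_eq_zero_of_notMem_tsupport hp']
  · intro y hy
    have hy' : y ∉ tsupport g := fun h => hy (g.tsupport_subset h)
    simp [complexTensor, image_eq_zero_of_notMem_tsupport hy']

theorem isLagrangianDistribution_forwardKernel (hdist : 0 < setEDist D.surface D.path)
    (hA : IsSymbol m (D.base : Set ((ℝ × ℝ) × (ℝ × ℝ))) A) :
    IsLagrangianDistribution (opensProd D.dataDomain D.visible) D.Λ (m - 1 / 2)
      (forwardKernel hdist hA) := by
  have hH := contDiffOn_delay hdist
  have he := fderiv_delay_timeDirection hdist
  let ℓ : EuclideanSpace ℝ (Fin 1) ≃ₗᵢ[ℝ] ℝ := (OrthonormalBasis.singleton (Fin 1) ℝ).repr.symm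
  let Ω : Set (((ℝ × ℝ) × (ℝ × ℝ)) × EuclideanSpace ℝ (Fin 1)) := D.base ×ˢ {θ | θ ≠ 0}
  -- The phase is `-ω H`; it parametrizes the same `Λ` as `ω H`, because the conormal bundle is
  -- invariant under change of sign of covectors.
  let φ := linearPhase (Θ := EuclideanSpace ℝ (Fin 1)) D.delay
    (ℓ.toContinuousLinearEquiv.trans (.neg ℝ))
  let P : OscillatoryData ((ℝ × ℝ) × (ℝ × ℝ)) :=
    { N := 1, N_pos := one_pos, U := Ω, Γ := Ω, φ := φ, a := fun p => A (p.1, ℓ p.2) }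
  have hP : P.IsAdmissible D.base D.Λ (m - 1 / 2) :=
    { base := fun p hp => hp.1
      phase := isNondegeneratePhase_linearPhase D.base.isOpen hH he _
      parametrizes := by
        rw [Λ_eq_conormalBundle hdist]
        exact parametrizesOpenPart_linearPhase D.base.isOpen hH he _
      symbol := by
        have h4 : m - 1 / 2 + (Module.finrank ℝ ((ℝ × ℝ) × (ℝ × ℝ)) : ℝ) / 4 - ((1 : ℕ) : ℝ) / 2
            = m := by
          simp
          ring
        change IsSymbol (m - 1 / 2 + (Module.finrank ℝ ((ℝ × ℝ) × (ℝ × ℝ)) : ℝ) / 4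
          - ((1 : ℕ) : ℝ) / 2) _ _
        rw [h4]
        exact hA.comp_linearIsometryEquiv ℓ
      cone_subset := subset_rfl
      cone_conic := fun p hp r hr => ⟨hp.1, smul_ne_zero hr.ne' hp.2⟩
      cone_closed := ⟨univ, isClosed_univ, (univ_inter _).symm⟩
      support := fun p h1 h2 h3 => absurd ⟨h1, h2⟩ h3 }
  -- A single oscillatory integral represents the kernel on the whole base, with zero smooth
  -- remainder.
  refine fun x₀ hx₀ => ⟨D.base, D.base.isOpen, hx₀, subset_rfl, 1, fun _ => P, 0, fun _ => hP,
    contDiffOn_const, fun f _ => ⟨fun _ => oscPairing D.delay A fun x => (f x : ℂ), fun _ => ?_, ?_⟩⟩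
  · exact isOscillatoryIntegral_linearPhase D.base.isOpen hH he hA ℓ ℓ.measurePreserving
      f.contDiff f.hasCompactSupport f.tsupport_subset
  · simp
    rfl

end SAR

theorem proposition1 (D : SAR) (hdist : 0 < setEDist D.surface D.path)
    (A : ((ℝ × ℝ) × (ℝ × ℝ)) × ℝ → ℂ)
    (hA : IsSymbol 2 (D.base : Set ((ℝ × ℝ) × (ℝ × ℝ))) A) :
    IsNondegeneratePhase D.phaseDomain D.phase ∧
    IsConicLagrangian (D.base : Set ((ℝ × ℝ) × (ℝ × ℝ))) D.Λ ∧
    D.Λ = lagrangianMap D.phase '' criticalSet D.phaseDomain D.phase ∧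
    ∃ F : 𝓓(D.visible, ℂ) →ₗ[ℂ] 𝓓'(D.dataDomain, ℂ),
      D.IsForwardOperator A F ∧ IsFourierIntegralOperator D.Λ (3 / 2) F := by
  have hH := SAR.contDiffOn_delay hdist
  refine ⟨?_, SAR.isConicLagrangian_Λ hdist, ?_, SAR.forwardOperator hdist hA,
    SAR.isForwardOperator_forwardOperator hdist hA, SAR.isConicLagrangian_Λ hdist,
    SAR.forwardKernel hdist hA, SAR.isSchwartzKernel_forwardKernel hdist hA, ?_⟩
  -- By definition, `D.phase` is the linear phase of `D.delay` for the identity of the real line.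
  · exact isNondegeneratePhase_linearPhase D.base.isOpen hH
      (SAR.fderiv_delay_timeDirection hdist) (.refl ℝ ℝ)
  · rw [SAR.Λ_eq_conormalBundle hdist]
    exact (lagrangianMap_image_linearPhase D.base.isOpen hH (.refl ℝ ℝ)).symm
  · have h := SAR.isLagrangianDistribution_forwardKernel hdist hA
    norm_num at h
    exact h

end
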